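/- All graphs are simple, connected and locally finite. For an infinite (vertex-)transitive graph $\mathbb G=(\mathbb V,\mathbb E)$ with a distinguished vertex $0$ (the origin), and a finite set $\Lambda\subset\mathbb V$, let $E_\Lambda$ be the set of edges of $\mathbb G$ with both endpoints in $\Lambda$ and $\partial\Lambda$ the set of vertices of $\Lambda$ that have a neighbour outside $\Lambda$. For $p\in[0,1]$ and $q\ge 1$, the wired random-cluster measure $\phi^1_{\Lambda,p,q}$ is the probability measure on subsets $\omega\subset E_\Lambda$ with $\phi^1_{\Lambda,p,q}[\omega]$ proportional to $p^{|\omega|}(1-p)^{|E_\Lambda\setminus\omega|}q^{k_1(\omega)}$, where $k_1(\omega)$ is the number of connected components of $(\Lambda,\omega)$, all components intersecting $\partial\Lambda$ being counted as one. Let $\phi^1_{\mathbb G,p,q}$ be the weak limit of $\phi^1_{\Lambda,p,q}$, on $\{0,1\}^{\mathbb E}$, as $\Lambda$ increases to $\mathbb V$, and let $$p_c(\mathbb G,q):=\inf\{p\in[0,1]:\ \phi^1_{\mathbb G,p,q}[0\longleftrightarrow\infty]>0\},$$ where $\{0\longleftrightarrow\infty\}$ is the event that the connected component of $0$ in $\omega$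 is infinite. A sequence $(\mathbb G_n)$ of infinite transitive graphs converges locally to an infinite transitive graph $\mathbb G$ if for every $R>0$ there is $N$ such that for all $n\ge N$ the balls of radius $R$ around the origin (for the graph distance) in $\mathbb G_n$ and in $\mathbb G$ are isomorphic as rooted graphs. **Proposition.** Fix $q\ge 1$. Let $(\mathbb G_n)$ be a sequence of infinite transitive graphs converging locally to an infinite transitive graph $\mathbb G$. Then $$\liminf_{n\to\infty}p_c(\mathbb G_n,q)\ \ge\ p_c(\mathbb G,q).$$ -/

import Mathlib

open Filter MeasureTheory
open scoped Topology BoundedContinuousFunction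

noncomputable section

namespace RandomCluster

universe u v

variable {V : Type u} {W : Type v}

/-- The standing assumptions on a graph: infinite, connected, locally finite, and
vertex-transitive (the automorphism group acts transitively on the vertices). -/
structure IsInfiniteTransitive (G : SimpleGraph V) : Prop where
  infinite : Infinite V
  connected : G.Connected
  locallyFinite : ∀ x : V, (G.neighborSet x).Finite
  transitive : ∀ x y : V, ∃ φ : G ≃g G, φ x = y

/-- Percolation configurations on `G`, i.e. elements of `{0,1}^E`, with the product topology and
the product sigma-algebra (`true` means that the edge is open). -/
abbrev Config (G : SimpleGraph V) : Type u := G.edgeSet → Bool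

/-- The subgraph of `G` formed by all the vertices and by the open edges of `ω`. -/
def openGraph {G : SimpleGraph V} (ω : Config G) : SimpleGraph V where
  Adj x y := ∃ h : s(x, y) ∈ G.edgeSet, ω ⟨s(x, y), h⟩ = true
  symm := ⟨fun x y ⟨h, hω⟩ => by
    have e : s(y, x) = s(x, y) := Sym2.eq_swap
    exact ⟨e ▸ h, by simpa only [e] using hω⟩⟩
  loopless := ⟨fun _ ⟨h, _⟩ => G.irrefl h⟩

/-- The event that the connected component of `o` in `ω` is infinite. -/
def connectedToInfinity (G : SimpleGraph V) (o : V) : Set (Config G) :=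
  {ω | {x : V | (openGraph ω).Reachable o x}.Infinite}

/-! ### Wired random-cluster measures in finite volume -/

open Classical in
/-- The edges of `G` with both endpoints in the finite set `Λ`: the edge set of the finite subgraph
of `G` induced by `Λ`. -/
def edgesIn (G : SimpleGraph V) (Λ : Finset V) : Finset G.edgeSet :=
  Λ.sym2.subtype (· ∈ G.edgeSet)

/-- The vertex boundary of `Λ`: the vertices of `Λ` with a neighbour outside `Λ`. -/
def vertexBoundary (G : SimpleGraph V) (Λ : Finset V) : Set V :=
  {x | x ∈ Λ ∧ ∃ y, y ∉ Λ ∧ G.Adj x y}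

/-- The graph with vertex set `Λ` whose edges are those of `ω`, together with an additional edge
between any two distinct vertices of the boundary of `Λ`. -/
def wiredGraph (G : SimpleGraph V) (Λ : Finset V) (ω : Finset G.edgeSet) : SimpleGraph Λ :=
  SimpleGraph.fromRel fun x y : Λ =>
    (∃ e ∈ ω, (e : Sym2 V) = s((x : V), (y : V))) ∨
      ((x : V) ∈ vertexBoundary G Λ ∧ (y : V) ∈ vertexBoundary G Λ)

/-- The number `k₁(ω)` of connected components of `(Λ, ω)`, where all the components intersecting
the boundary of `Λ` are counted as one. -/
def wiredComponents (G : SimpleGraph V) (Λ : Finset V) (ω : Finset G.edgeSet) : ℕ :=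
  Nat.card (wiredGraph G Λ ω).ConnectedComponent

open Classical in
/-- The unnormalised weight `p^|ω| (1-p)^|E ∖ ω| q^{k₁(ω)}`. For `p < 1` it is the weight
`(p/(1-p))^|ω| q^{k₁(ω)}` multiplied by the constant `(1-p)^|E|`, which the normalisation
removes; it also makes sense at `p = 1`, where all the edges are open. -/
def wiredWeight (G : SimpleGraph V) (p q : ℝ) (Λ : Finset V) (ω : Finset G.edgeSet) : ℝ :=
  p ^ ω.card * (1 - p) ^ (edgesIn G Λ \ ω).card * q ^ wiredComponents G Λ ω

/-- The partition function. -/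
def wiredPartition (G : SimpleGraph V) (p q : ℝ) (Λ : Finset V) : ℝ :=
  ∑ ω ∈ (edgesIn G Λ).powerset, wiredWeight G p q Λ ω

open Classical in
/-- The random-cluster measure with wired boundary conditions on the finite subgraph of `G` induced
by `Λ`, seen as a measure on configurations on `G` by declaring closed the edges that are not in
this subgraph. -/
def finiteVolumeMeasure (G : SimpleGraph V) (p q : ℝ) (Λ : Finset V) : Measure (Config G) :=
  ∑ ω ∈ (edgesIn G Λ).powerset,
    ENNReal.ofReal (wiredWeight G p q Λ ω / wiredPartition G p q Λ) •
      Measure.dirac (fun e => decide (e ∈ ω))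

/-! ### The infinite-volume measure and the critical point -/

/-- `μ` is a probability measure and is the weak limit of the wired finite-volume random-cluster
measures as `Λ` increases to the whole vertex set (along the finite sets ordered by inclusion). -/
structure IsWiredLimit (G : SimpleGraph V) (p q : ℝ) (μ : Measure (Config G)) : Prop where
  isProbabilityMeasure : IsProbabilityMeasure μ
  tendsto : ∀ f : Config G →ᵇ ℝ,
    Tendsto (fun Λ : Finset V => ∫ ω, f ω ∂(finiteVolumeMeasure G p q Λ)) atTop
      (𝓝 (∫ ω, f ω ∂μ))

open Classical in
/-- The wired infinite-volume random-cluster measure on `G`: the weak limit of the wired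
finite-volume measures (and zero if there is no such limit, which does not happen for a connected
locally finite graph, `p ∈ [0,1]` and `q ≥ 1`). -/
def wiredMeasure (G : SimpleGraph V) (p q : ℝ) : Measure (Config G) :=
  if h : ∃ μ : Measure (Config G), IsWiredLimit G p q μ then h.choose else 0

/-- The critical point `p_c(G,q)`: the infimum of the `p ∈ [0,1]` for which the component of the
origin `o` is infinite with positive probability under the wired measure. -/
def criticalPoint (G : SimpleGraph V) (o : V) (q : ℝ) : ℝ :=
  sInf {p : ℝ | p ∈ Set.Icc (0 : ℝ) 1 ∧ 0 < wiredMeasure G p q (connectedToInfinity G o)}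

/-! ### Local convergence -/

/-- The vertex set of the (closed) ball of radius `R` around `o` for the graph distance. -/
def closedBall (G : SimpleGraph V) (o : V) (R : ℕ) : Set V :=
  {x | G.dist o x ≤ R}

/-- The balls of radius `R` in `(G, o)` and `(H, o')`, seen as induced subgraphs, are isomorphic as
rooted graphs. -/
def BallsIsomorphic (G : SimpleGraph V) (o : V) (H : SimpleGraph W) (o' : W) (R : ℕ) : Prop :=
  ∃ φ : G.induce (closedBall G o R) ≃g H.induce (closedBall H o' R),
    ∀ x : closedBall G o R, (x : V) = o → (φ x : W) = o'

/-- Local convergence of the rooted graphs `(G n, o n)` to the rooted graph `(H, o')`: for every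
`R`, the balls of radius `R` are eventually isomorphic. -/
def ConvergesLocally {V : ℕ → Type u} (G : ∀ n, SimpleGraph (V n)) (o : ∀ n, V n)
    (H : SimpleGraph W) (o' : W) : Prop :=
  ∀ R : ℕ, ∃ N : ℕ, ∀ n ≥ N, BallsIsomorphic (G n) (o n) H o' R

end RandomCluster

end

/-! The argument reduces `criticalPoint` to a quantity that sees only a finite ball. Let `theta G p
q o m` be the probability, under the wired measure in the ball of radius `m`, that `o` is connected
to distance `m`. It depends only on the ball of radius `m + 1` (`theta_eq_of_ballsIsomorphic`), so
under local convergence it is eventually the same for `G n` and for the limit.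

Two facts connect it to the critical point. Strictly between 0 and the critical point there is no
percolation, so weak convergence makes `theta` arbitrarily small for a suitable radius
(`exists_theta_lt_of_lt_criticalPoint`). Conversely, if `theta G p q o m < t` for a single `m`, then
the critical point is at least `p - 2 * t`, with no other dependence on the graph
(`le_criticalPoint`). Applying the first fact to the limit graph and the second to `G n` gives the
bound.

The second fact is a quantitative form of sharpness, proved through the OSSS inequality for measures
satisfying the FKG lattice condition (`cov_eval_le`). Exploring the clusters of a sphere of radius
`k` decides whether `o` reaches distance `n`. Averaging over `k` from 1 to `n`, an edge is revealed
with probability at most of order `m / n + theta G p q o m`, because a vertex at distance at least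
`m` from the sphere must be connected to distance `m`. With the formula for the derivative in `p`,
this yields `g ≤ t * g'` for the connection probability `g` when `n` is large. Hence `g` loses a
factor `e > 2` on an interval of length `t`. Iterating with `t`, `t / 2`, `t / 4`, ... costs `2 * t`
in total and sends the connection probabilities to zero (`exists_theta_lt`).

The lattice condition and the monotonicity in the domain both follow from supermodularity of the
number of wired clusters (`wiredComponents_add_le`), which is a dimension count for spaces of
functions. -/

set_option linter.unusedSectionVars false

noncomputable section

namespace RandomCluster

universe u v

/-! ### Holley and FKG inequalities on a Boolean lattice, and conditioning on finitely many edges.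
-/

section WeightedMean

variable {ι : Type*} [DecidableEq ι]

/-- The mean of `f` for the probability measure on the subsets of `E` with weights `w`. -/
def mean (E : Finset ι) (w f : Finset ι → ℝ) : ℝ :=
  (∑ a ∈ E.powerset, w a * f a) / ∑ a ∈ E.powerset, w a

/-- The covariance of `f` and `g` for the probability measure with weights `w`. -/
def cov (E : Finset ι) (w f g : Finset ι → ℝ) : ℝ :=
  mean E w (fun a => f a * g a) - mean E w f * mean E w g

/-- The indicator function that `e` is open. -/
def openAt (e : ι) (a : Finset ι) : ℝ := if e ∈ a then 1 else 0

/-- The weights restricted to the configurations whose trace on `F` is `x`. -/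
def fiber (w : Finset ι → ℝ) (F x : Finset ι) (a : Finset ι) : ℝ := if a ∩ F = x then w a else 0

/-- `f` is increasing among the subsets of `E`. -/
def IncreasingOn (E : Finset ι) (f : Finset ι → ℝ) : Prop :=
  ∀ a b, a ⊆ b → b ⊆ E → f a ≤ f b

/-- Nonnegative weights, positive on the subsets of `E`, that satisfy the FKG lattice condition. -/
structure IsLatticeWeight (E : Finset ι) (w : Finset ι → ℝ) : Prop where
  nonneg : ∀ a, 0 ≤ w a
  pos : ∀ a, a ⊆ E → 0 < w a
  lattice : ∀ a b, a ⊆ E → b ⊆ E → w a * w b ≤ w (a ∩ b) * w (a ∪ b)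

/-- Holley's inequality, on a Boolean lattice. -/
theorem holley_powerset (E : Finset ι) (w₁ w₂ f : Finset ι → ℝ) (h₁ : ∀ a, 0 ≤ w₁ a)
    (h₂ : ∀ a, 0 ≤ w₂ a) (hf : ∀ a, 0 ≤ f a) (hmono : IncreasingOn E f)
    (h : ∀ a b, a ⊆ E → b ⊆ E → w₁ a * w₂ b ≤ w₁ (a ∩ b) * w₂ (a ∪ b)) :
    (∑ a ∈ E.powerset, w₁ a * f a) * ∑ a ∈ E.powerset, w₂ a ≤
      (∑ a ∈ E.powerset, w₁ a) * ∑ a ∈ E.powerset, w₂ a * f a := by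
  -- Attaching `f` to `w₁` at `a` and to `w₂` at `a ∪ b` keeps the four-function hypothesis, since
  -- `f a ≤ f (a ∪ b)`.
  have := Finset.four_functions_theorem (f₁ := fun a => w₁ a * f a) (f₂ := w₂) (f₃ := w₁)
    (f₄ := fun a => w₂ a * f a) E (fun a => mul_nonneg (h₁ a) (hf a)) h₂ h₁
    (fun a => mul_nonneg (h₂ a) (hf a)) (fun a ha b hb => ?_)
    (𝒜 := E.powerset) (ℬ := E.powerset) subset_rfl subset_rfl
  · simpa using this
  · calc w₁ a * f a * w₂ b = (w₁ a * w₂ b) * f a := by ring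
      _ ≤ (w₁ (a ∩ b) * w₂ (a ∪ b)) * f (a ∪ b) :=
        mul_le_mul (h a b ha hb) (hmono _ _ Finset.subset_union_left (Finset.union_subset ha hb))
          (hf _) (mul_nonneg (h₁ _) (h₂ _))
      _ = _ := by ring

/-- Stochastic domination of one weighted measure by another one. -/
theorem mean_le_mean_of_holley (E : Finset ι) (w₁ w₂ f : Finset ι → ℝ) (h₁ : ∀ a, 0 ≤ w₁ a)
    (h₂ : ∀ a, 0 ≤ w₂ a) (hf : ∀ a, 0 ≤ f a) (hmono : IncreasingOn E f)
    (h : ∀ a b, a ⊆ E → b ⊆ E → w₁ a * w₂ b ≤ w₁ (a ∩ b) * w₂ (a ∪ b))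
    (p₁ : 0 < ∑ a ∈ E.powerset, w₁ a) (p₂ : 0 < ∑ a ∈ E.powerset, w₂ a) :
    mean E w₁ f ≤ mean E w₂ f := by
  rw [mean, mean, div_le_div_iff₀ p₁ p₂, mul_comm (∑ a ∈ E.powerset, w₂ a * f a)]
  exact holley_powerset E w₁ w₂ f h₁ h₂ hf hmono h

variable {E : Finset ι} {w : Finset ι → ℝ}

theorem IsLatticeWeight.sum_pos (hw : IsLatticeWeight E w) : 0 < ∑ a ∈ E.powerset, w a :=
  Finset.sum_pos (fun a ha => hw.pos a (Finset.mem_powerset.1 ha)) ⟨∅, by simp⟩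

/-- The FKG inequality. -/
theorem IsLatticeWeight.cov_nonneg (hw : IsLatticeWeight E w) {f g : Finset ι → ℝ}
    (hf : ∀ a, 0 ≤ f a) (hg : ∀ a, 0 ≤ g a) (hfm : IncreasingOn E f) (hgm : IncreasingOn E g) :
    0 ≤ cov E w f g := by
  -- FKG is Holley for `w` against its tilt `w * g`: the tilted measure dominates.
  have := holley_powerset E w (fun a => w a * g a) f hw.nonneg
    (fun a => mul_nonneg (hw.nonneg a) (hg a)) hf hfm (fun a b ha hb => by
      calc w a * (w b * g b) = (w a * w b) * g b := by ring
        _ ≤ (w (a ∩ b) * w (a ∪ b)) * g (a ∪ b) :=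
          mul_le_mul (hw.lattice a b ha hb)
            (hgm _ _ Finset.subset_union_right (Finset.union_subset ha hb))
            (hg _) (mul_nonneg (hw.nonneg _) (hw.nonneg _))
        _ = _ := by ring)
  have hp := hw.sum_pos
  rw [cov, sub_nonneg, mean, mean, mean, div_mul_div_comm, div_le_div_iff₀ (by positivity) hp]
  have e : ∑ a ∈ E.powerset, w a * (f a * g a) = ∑ a ∈ E.powerset, w a * g a * f a :=
    Finset.sum_congr rfl fun a _ => by ring
  rw [e]
  nlinarith [this]

theorem mean_add (f g : Finset ι → ℝ) :
    mean E w (fun a => f a + g a) = mean E w f + mean E w g := by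
  simp only [mean, mul_add, Finset.sum_add_distrib, add_div]

theorem mean_const_mul (c : ℝ) (f : Finset ι → ℝ) :
    mean E w (fun a => c * f a) = c * mean E w f := by
  simp only [mean, mul_left_comm _ c, ← Finset.mul_sum, mul_div_assoc]

theorem mean_sum {κ : Type*} (s : Finset κ) (f : κ → Finset ι → ℝ) :
    mean E w (fun a => ∑ i ∈ s, f i a) = ∑ i ∈ s, mean E w (f i) := by
  simp only [mean, Finset.mul_sum, ← Finset.sum_div]
  rw [Finset.sum_comm]

theorem mean_const (h : 0 < ∑ a ∈ E.powerset, w a) (c : ℝ) : mean E w (fun _ => c) = c := by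
  rw [mean, ← Finset.sum_mul, mul_div_right_comm, div_self h.ne', one_mul]

theorem mean_le_mean (hw : ∀ a, 0 ≤ w a) {f g : Finset ι → ℝ}
    (h : ∀ a, a ⊆ E → w a ≠ 0 → f a ≤ g a) : mean E w f ≤ mean E w g := by
  refine div_le_div_of_nonneg_right (Finset.sum_le_sum fun a ha => ?_)
    (Finset.sum_nonneg fun a _ => hw a)
  by_cases h0 : w a = 0
  · simp [h0]
  · exact mul_le_mul_of_nonneg_left (h a (Finset.mem_powerset.1 ha) h0) (hw a)

theorem mean_congr {f g : Finset ι → ℝ} (h : ∀ a, a ⊆ E → w a ≠ 0 → f a = g a) :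
    mean E w f = mean E w g := by
  unfold mean
  congr 1
  refine Finset.sum_congr rfl fun a ha => ?_
  by_cases h0 : w a = 0
  · simp [h0]
  · rw [h a (Finset.mem_powerset.1 ha) h0]

theorem mean_nonneg (hw : ∀ a, 0 ≤ w a) {f : Finset ι → ℝ} (h : ∀ a, 0 ≤ f a) :
    0 ≤ mean E w f :=
  div_nonneg (Finset.sum_nonneg fun a _ => mul_nonneg (hw a) (h a))
    (Finset.sum_nonneg fun a _ => hw a)

/-! ### Conditioning on the state of finitely many edges -/

theorem fiber_nonneg (hw : IsLatticeWeight E w) (F x a : Finset ι) : 0 ≤ fiber w F x a := by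
  unfold fiber; split_ifs; exacts [hw.nonneg a, le_rfl]

theorem inter_eq_of_fiber_ne_zero {F x a : Finset ι} (h : fiber w F x a ≠ 0) : a ∩ F = x := by
  by_contra h'; exact h (if_neg h')

theorem sum_fiber_pos (hw : IsLatticeWeight E w) {F x : Finset ι} (hF : F ⊆ E) (hx : x ⊆ F) :
    0 < ∑ a ∈ E.powerset, fiber w F x a := by
  refine Finset.sum_pos' (fun a _ => fiber_nonneg hw F x a)
    ⟨x, Finset.mem_powerset.2 (hx.trans hF), ?_⟩
  rw [fiber, if_pos (Finset.inter_eq_left.2 hx)]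
  exact hw.pos x (hx.trans hF)

theorem fiber_empty : fiber w ∅ ∅ = w := by
  ext a; simp [fiber]

/-- If `a` and `b` have traces `x ⊆ y` on `F`, then `a ∩ b` and `a ∪ b` have traces `x` and `y`, so
the lattice condition of `w` gives Holley's condition between the two fibers. -/
theorem mean_fiber_mono (hw : IsLatticeWeight E w) {F x y : Finset ι} (hF : F ⊆ E) (hxy : x ⊆ y)
    (hy : y ⊆ F) {f : Finset ι → ℝ} (hf : ∀ a, 0 ≤ f a) (hmono : IncreasingOn E f) :
    mean E (fiber w F x) f ≤ mean E (fiber w F y) f := by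
  refine mean_le_mean_of_holley E _ _ f (fiber_nonneg hw F x) (fiber_nonneg hw F y) hf hmono
    (fun a b ha hb => ?_) (sum_fiber_pos hw hF (hxy.trans hy)) (sum_fiber_pos hw hF hy)
  by_cases h1 : a ∩ F = x
  · by_cases h2 : b ∩ F = y
    · have e1 : (a ∩ b) ∩ F = x := by
        rw [Finset.inter_inter_distrib_right, h1, h2, Finset.inter_eq_left.2 hxy]
      have e2 : (a ∪ b) ∩ F = y := by
        rw [Finset.union_inter_distrib_right, h1, h2, Finset.union_eq_right.2 hxy]
      simp only [fiber, h1, h2, e1, e2, if_true]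
      exact hw.lattice a b ha hb
    · rw [fiber, fiber, if_neg h2, mul_zero]
      exact mul_nonneg (fiber_nonneg hw _ _ _) (fiber_nonneg hw _ _ _)
  · rw [fiber, if_neg h1, zero_mul]
    exact mul_nonneg (fiber_nonneg hw _ _ _) (fiber_nonneg hw _ _ _)

theorem openAt_nonneg (e : ι) (a : Finset ι) : 0 ≤ openAt e a := by
  unfold openAt; split_ifs <;> norm_num

theorem openAt_le_one (e : ι) (a : Finset ι) : openAt e a ≤ 1 := by
  unfold openAt; split_ifs <;> norm_num

theorem openAt_increasing (e : ι) : IncreasingOn E (openAt e) := by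
  intro a b hab _
  unfold openAt
  split_ifs with h1 h2 h2
  · exact le_rfl
  · exact absurd (hab h1) h2
  · norm_num
  · exact le_rfl

/-- The conditional probability that `e` is open, given the trace `x` on `F`. -/
def condOpen (E : Finset ι) (w : Finset ι → ℝ) (F x : Finset ι) (e : ι) : ℝ :=
  mean E (fiber w F x) (openAt e)

theorem condOpen_nonneg (hw : IsLatticeWeight E w) (F x : Finset ι) (e : ι) :
    0 ≤ condOpen E w F x e :=
  mean_nonneg (fiber_nonneg hw F x) (openAt_nonneg e)

theorem condOpen_le_one (hw : IsLatticeWeight E w) {F x : Finset ι} (hF : F ⊆ E) (hx : x ⊆ F)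
    (e : ι) : condOpen E w F x e ≤ 1 := by
  have := mean_le_mean (E := E) (fiber_nonneg hw F x) (f := openAt e) (g := fun _ => 1)
    (fun a _ _ => openAt_le_one e a)
  rwa [mean_const (sum_fiber_pos hw hF hx)] at this

theorem sum_fiber_split {F x : Finset ι} (hx : x ⊆ F) {e : ι} (he : e ∉ F) (f : Finset ι → ℝ) :
    ∑ a ∈ E.powerset, fiber w F x a * f a =
      ∑ a ∈ E.powerset, fiber w (insert e F) (insert e x) a * f a +
        ∑ a ∈ E.powerset, fiber w (insert e F) x a * f a := by
  rw [← Finset.sum_add_distrib]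
  refine Finset.sum_congr rfl fun a _ => ?_
  have hex : e ∉ x := fun h => he (hx h)
  rw [← add_mul]
  congr 1
  unfold fiber
  by_cases hea : e ∈ a
  · rw [Finset.inter_insert_of_mem hea]
    have h1 : insert e (a ∩ F) = insert e x ↔ a ∩ F = x := by
      constructor
      · intro h
        have := congrArg (fun s => s.erase e) h
        simpa [Finset.erase_insert, he, hex] using this
      · rintro rfl; rfl
    have h2 : insert e (a ∩ F) ≠ x := fun h => hex (h ▸ Finset.mem_insert_self _ _)
    simp only [h1, h2, if_false, add_zero]
  · rw [Finset.inter_insert_of_notMem hea]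
    have h2 : a ∩ F ≠ insert e x := fun h =>
      hea (Finset.mem_inter.1 (h ▸ Finset.mem_insert_self e x : e ∈ a ∩ F)).1
    simp only [h2, if_false, zero_add]

theorem sum_fiber_openAt {F x : Finset ι} (hx : x ⊆ F) {e : ι} (he : e ∉ F) :
    ∑ a ∈ E.powerset, fiber w F x a * openAt e a =
      ∑ a ∈ E.powerset, fiber w (insert e F) (insert e x) a := by
  have hex : e ∉ x := fun h => he (hx h)
  rw [sum_fiber_split hx he]
  have h0 : ∑ a ∈ E.powerset, fiber w (insert e F) x a * openAt e a = 0 := by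
    refine Finset.sum_eq_zero fun a _ => ?_
    by_cases hea : e ∈ a
    · rw [fiber, if_neg, zero_mul]
      intro h
      exact hex (h ▸ Finset.mem_inter.2 ⟨hea, Finset.mem_insert_self _ _⟩)
    · rw [openAt, if_neg hea, mul_zero]
  rw [h0, add_zero]
  refine Finset.sum_congr rfl fun a _ => ?_
  by_cases hea : e ∈ a
  · rw [openAt, if_pos hea, mul_one]
  · rw [fiber, if_neg, zero_mul]
    intro h
    exact hea (Finset.mem_inter.1 (h ▸ Finset.mem_insert_self e x : e ∈ a ∩ insert e F)).1

/-- Conditioning on the state of one more edge. -/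
theorem mean_fiber_split (hw : IsLatticeWeight E w) {F x : Finset ι} (hF : F ⊆ E) (hx : x ⊆ F)
    {e : ι} (heE : e ∈ E) (he : e ∉ F) (f : Finset ι → ℝ) :
    mean E (fiber w F x) f =
      condOpen E w F x e * mean E (fiber w (insert e F) (insert e x)) f +
        (1 - condOpen E w F x e) * mean E (fiber w (insert e F) x) f := by
  have hF' : insert e F ⊆ E := Finset.insert_subset heE hF
  have p0 := sum_fiber_pos hw hF hx
  have p1 := sum_fiber_pos hw hF' (Finset.insert_subset_insert e hx)
  have p2 := sum_fiber_pos hw hF' (hx.trans (Finset.subset_insert e F))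
  have s1 := sum_fiber_split (E := E) (w := w) hx he (fun _ => 1)
  simp only [mul_one] at s1
  rw [condOpen, mean, mean, mean, mean, sum_fiber_openAt hx he, sum_fiber_split hx he]
  rw [s1] at p0 ⊢
  field_simp
  ring

/-- The law of total expectation. -/
theorem mean_mean_fiber (hw : IsLatticeWeight E w) {F : Finset ι} (hF : F ⊆ E)
    (f : Finset ι → ℝ) :
    mean E w (fun a => mean E (fiber w F (a ∩ F)) f) = mean E w f := by
  unfold mean
  congr 1
  have key : ∀ h : Finset ι → ℝ, ∑ a ∈ E.powerset, w a * h a =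
      ∑ y ∈ F.powerset, ∑ a ∈ E.powerset, fiber w F y a * h a := by
    intro h
    rw [Finset.sum_comm]
    refine Finset.sum_congr rfl fun a _ => ?_
    simp only [fiber, ite_mul, zero_mul]
    rw [Finset.sum_ite_eq, if_pos (Finset.mem_powerset.2 Finset.inter_subset_right)]
  rw [key, key f]
  refine Finset.sum_congr rfl fun y hy => ?_
  have p := sum_fiber_pos hw hF (Finset.mem_powerset.1 hy)
  have : ∀ a ∈ E.powerset, fiber w F y a * ((∑ b ∈ E.powerset, fiber w F (a ∩ F) b * f b) /
      ∑ b ∈ E.powerset, fiber w F (a ∩ F) b) = fiber w F y a *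
      ((∑ b ∈ E.powerset, fiber w F y b * f b) / ∑ b ∈ E.powerset, fiber w F y b) := by
    intro a _
    by_cases h0 : fiber w F y a = 0
    · simp [h0]
    · rw [inter_eq_of_fiber_ne_zero h0]
  rw [Finset.sum_congr rfl this, ← Finset.sum_mul, mul_div_cancel₀ _ p.ne']

/-- The trace on one more edge can be sampled in two stages, the second one being a Bernoulli
variable of parameter `condOpen`. This puts the induction hypotheses of the OSSS proof in a form
comparable with the coupling. -/
theorem mean_comp_inter_insert (hw : IsLatticeWeight E w) {F : Finset ι} (hF : F ⊆ E) {e : ι}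
    (heE : e ∈ E) (he : e ∉ F) (ψ : Finset ι → ℝ) :
    mean E w (fun a => ψ (a ∩ insert e F)) =
      mean E w (fun a => condOpen E w F (a ∩ F) e * ψ (insert e (a ∩ F)) +
        (1 - condOpen E w F (a ∩ F) e) * ψ (a ∩ F)) := by
  rw [← mean_mean_fiber hw hF]
  congr 1
  ext a
  have hF' : insert e F ⊆ E := Finset.insert_subset heE hF
  have hx : a ∩ F ⊆ F := Finset.inter_subset_right
  rw [mean_fiber_split hw hF hx heE he]
  have h : ∀ y, y ⊆ insert e F →
      mean E (fiber w (insert e F) y) (fun a => ψ (a ∩ insert e F)) = ψ y := by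
    intro y hy
    rw [mean_congr (g := fun _ => ψ y) (fun a _ h0 => by rw [inter_eq_of_fiber_ne_zero h0])]
    exact mean_const (sum_fiber_pos hw hF' hy) _
  rw [h _ (Finset.insert_subset_insert e hx), h _ (hx.trans (Finset.subset_insert e F))]

end WeightedMean

/-! ### Decision trees and the OSSS inequality under the FKG lattice condition. -/

section DecisionTrees

/-- A decision tree that queries edges one after the other and returns a real number. The first
subtree is followed when the edge is closed and the second one when it is open. -/
inductive DecisionTree (ι : Type*) where
  | leaf (c : ℝ) : DecisionTree ι
  | node (e : ι) (t₀ t₁ : DecisionTree ι) : DecisionTree ι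

variable {ι : Type*} [DecidableEq ι]

namespace DecisionTree

/-- The value returned by the tree on the configuration `a`. -/
def eval : DecisionTree ι → Finset ι → ℝ
  | leaf c, _ => c
  | node e t₀ t₁, a => if e ∈ a then t₁.eval a else t₀.eval a

/-- The set of edges queried by the tree on the configuration `a`. -/
def queried : DecisionTree ι → Finset ι → Finset ι
  | leaf _, _ => ∅
  | node e t₀ t₁, a => insert e (if e ∈ a then t₁.queried a else t₀.queried a)

/-- The tree queries only edges of `E`, none of `F` and none twice, and its values lie
in `[0, 1]`. -/
def WellFormed (E : Finset ι) : Finset ι → DecisionTree ι → Prop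
  | _, leaf c => 0 ≤ c ∧ c ≤ 1
  | F, node e t₀ t₁ => e ∈ E ∧ e ∉ F ∧ WellFormed E (insert e F) t₀ ∧ WellFormed E (insert e F) t₁

/-- The tree with all its values `c` replaced by `1 - c`. -/
def compl : DecisionTree ι → DecisionTree ι
  | leaf c => leaf (1 - c)
  | node e t₀ t₁ => node e t₀.compl t₁.compl

theorem WellFormed.compl {E : Finset ι} : ∀ {t : DecisionTree ι} {F : Finset ι},
    WellFormed E F t → WellFormed E F t.compl
  | leaf _, _, h => ⟨by linarith [h.2], by linarith [h.1]⟩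
  | node _ _ _, _, h => ⟨h.1, h.2.1, h.2.2.1.compl, h.2.2.2.compl⟩

theorem WellFormed.mono {E E' : Finset ι} (hE : E ⊆ E') : ∀ {t : DecisionTree ι} {F : Finset ι},
    WellFormed E F t → WellFormed E' F t
  | leaf _, _, h => h
  | node _ _ _, _, h => ⟨hE h.1, h.2.1, h.2.2.1.mono hE, h.2.2.2.mono hE⟩

theorem disjoint_queried {E : Finset ι} (a : Finset ι) : ∀ {t : DecisionTree ι} {F : Finset ι},
    WellFormed E F t → ∀ e ∈ F, e ∉ t.queried a
  | leaf _, _, _ => fun e _ => by simp [queried]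
  | node e' t₀ t₁, F, h => fun e he => by
    have h0 := disjoint_queried a h.2.2.1 e (Finset.mem_insert_of_mem he)
    have h1 := disjoint_queried a h.2.2.2 e (Finset.mem_insert_of_mem he)
    have hne : e ≠ e' := fun h' => h.2.1 (h' ▸ he)
    simp only [queried, Finset.mem_insert, not_or]
    refine ⟨hne, ?_⟩
    split_ifs <;> assumption

/-- The expectation of `(value of the tree on X) * f Y`, where the trace of `X` on `F` is `x`, that
of `Y` is `y`, and, along the tree, the edges of `X` and `Y` are sampled with the monotone coupling;
after the end of the tree, `Y` is completed according to its conditional law. -/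
def coupled (E : Finset ι) (w f : Finset ι → ℝ) :
    DecisionTree ι → Finset ι → Finset ι → Finset ι → ℝ
  | leaf c, F, _, y => c * mean E (fiber w F y) f
  | node e t₀ t₁, F, x, y =>
    min (condOpen E w F x e) (condOpen E w F y e) *
        t₁.coupled E w f (insert e F) (insert e x) (insert e y) +
      (condOpen E w F x e - min (condOpen E w F x e) (condOpen E w F y e)) *
        t₁.coupled E w f (insert e F) (insert e x) y +
      ((condOpen E w F y e - min (condOpen E w F x e) (condOpen E w F y e)) *
        t₀.coupled E w f (insert e F) x (insert e y) +
      (1 - condOpen E w F x e - (condOpen E w F y e -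
          min (condOpen E w F x e) (condOpen E w F y e))) *
        t₀.coupled E w f (insert e F) x y)

/-- The conditional expectation of the total cost of the queries, when querying `e` costs `C e`. -/
def expectedCost (E : Finset ι) (w : Finset ι → ℝ) (C : ι → ℝ) :
    DecisionTree ι → Finset ι → Finset ι → ℝ
  | leaf _, _, _ => 0
  | node e t₀ t₁, F, x => C e +
      (condOpen E w F x e * t₁.expectedCost E w C (insert e F) (insert e x) +
        (1 - condOpen E w F x e) * t₀.expectedCost E w C (insert e F) x)

variable {E : Finset ι} {w f : Finset ι → ℝ}

theorem condOpen_mono (hw : IsLatticeWeight E w) {F x y : Finset ι} (hF : F ⊆ E) (hxy : x ⊆ y)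
    (hy : y ⊆ F) (e : ι) : condOpen E w F x e ≤ condOpen E w F y e :=
  mean_fiber_mono hw hF hxy hy (openAt_nonneg e) (openAt_increasing e)

/-- The total mass `α` of both mixtures is the same; the second puts more of it on the larger value
and has larger values. -/
theorem mix_le_mix {m m' α A B A' B' : ℝ} (hm : 0 ≤ m) (hmm : m ≤ m') (hα : m ≤ α)
    (hA : A ≤ A') (hB : B ≤ B') (hBA : B' ≤ A') :
    m * A + (α - m) * B ≤ m' * A' + (α - m') * B' := by
  nlinarith [mul_le_mul_of_nonneg_left hA hm, mul_le_mul_of_nonneg_left hB (sub_nonneg.2 hα),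
    mul_nonneg (sub_nonneg.2 hmm) (sub_nonneg.2 hBA)]

/-- Raising the past of `Y` raises its conditional probability of opening the next edge. Given the
state of that edge in `X`, the monotone coupling then moves mass only from closed to open in `Y`,
which cannot decrease the result since the leaf values are nonnegative and `f` is increasing. -/
theorem coupled_mono (hw : IsLatticeWeight E w) (hf : ∀ a, 0 ≤ f a) (hmono : IncreasingOn E f) :
    ∀ (t : DecisionTree ι) {F x y z : Finset ι}, WellFormed E F t → F ⊆ E → x ⊆ F → y ⊆ z → z ⊆ F →
      t.coupled E w f F x y ≤ t.coupled E w f F x z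
  | leaf _, _, _, _, _, h, hF, _, hyz, hz =>
    mul_le_mul_of_nonneg_left (mean_fiber_mono hw hF hyz hz hf hmono) h.1
  | node e t₀ t₁, F, x, y, z, h, hF, hx, hyz, hz => by
    have hF' : insert e F ⊆ E := Finset.insert_subset h.1 hF
    have hx' : x ⊆ insert e F := hx.trans (Finset.subset_insert e F)
    have hx1 : insert e x ⊆ insert e F := Finset.insert_subset_insert e hx
    have hz' : z ⊆ insert e F := hz.trans (Finset.subset_insert e F)
    have hz1 : insert e z ⊆ insert e F := Finset.insert_subset_insert e hz
    have hyz1 : insert e y ⊆ insert e z := Finset.insert_subset_insert e hyz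
    have hzz : z ⊆ insert e z := Finset.subset_insert e z
    have hy := hyz.trans hz
    have a0 := condOpen_nonneg hw F x e
    have a1 := condOpen_le_one hw hF hx e
    have b0 := condOpen_nonneg hw F y e
    have bc := condOpen_mono hw hF hyz hz e
    have c1 := condOpen_le_one hw hF hz e
    simp only [coupled]
    refine add_le_add
      (mix_le_mix (le_min a0 b0) (min_le_min_left _ bc) (min_le_left _ _)
        (coupled_mono hw hf hmono t₁ h.2.2.2 hF' hx1 hyz1 hz1)
        (coupled_mono hw hf hmono t₁ h.2.2.2 hF' hx1 hyz hz')
        (coupled_mono hw hf hmono t₁ h.2.2.2 hF' hx1 hzz hz1))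
      (mix_le_mix (sub_nonneg.2 (min_le_right _ _)) ?_ ?_
        (coupled_mono hw hf hmono t₀ h.2.2.1 hF' hx' hyz1 hz1)
        (coupled_mono hw hf hmono t₀ h.2.2.1 hF' hx' hyz hz')
        (coupled_mono hw hf hmono t₀ h.2.2.1 hF' hx' hzz hz1))
    · rcases min_cases (condOpen E w F x e) (condOpen E w F y e) with h1 | h1 <;>
      rcases min_cases (condOpen E w F x e) (condOpen E w F z e) with h2 | h2 <;> linarith
    · rcases min_cases (condOpen E w F x e) (condOpen E w F y e) with h1 | h1 <;> linarith

/-- The leaf values of `t` and `t.compl` add up to 1, so what remains is the expectation of `f Y`: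
the second marginal of the coupling is the right conditional law, whatever the past of `X`. -/
theorem coupled_add_compl (hw : IsLatticeWeight E w) :
    ∀ (t : DecisionTree ι) {F x y : Finset ι}, WellFormed E F t → F ⊆ E → x ⊆ F → y ⊆ F →
      t.coupled E w f F x y + t.compl.coupled E w f F x y = mean E (fiber w F y) f
  | leaf c, _, _, _, _, _, _, _ => by simp only [coupled, compl]; ring
  | node e t₀ t₁, F, x, y, h, hF, hx, hy => by
    have hF' : insert e F ⊆ E := Finset.insert_subset h.1 hF
    have hx' : x ⊆ insert e F := hx.trans (Finset.subset_insert e F)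
    have hx1 : insert e x ⊆ insert e F := Finset.insert_subset_insert e hx
    have hy' : y ⊆ insert e F := hy.trans (Finset.subset_insert e F)
    have hy1 : insert e y ⊆ insert e F := Finset.insert_subset_insert e hy
    have i11 := coupled_add_compl hw t₁ h.2.2.2 hF' hx1 hy1
    have i10 := coupled_add_compl hw t₁ h.2.2.2 hF' hx1 hy'
    have i01 := coupled_add_compl hw t₀ h.2.2.1 hF' hx' hy1
    have i00 := coupled_add_compl hw t₀ h.2.2.1 hF' hx' hy'
    rw [mean_fiber_split hw hF hy h.1 h.2.1, ← i11]
    have j : mean E (fiber w (insert e F) y) f = _ := i10.symm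
    simp only [coupled, compl]
    have e1 := i11.trans i01.symm
    have e2 := i10.trans i00.symm
    rw [j]
    set m := min (condOpen E w F x e) (condOpen E w F y e)
    linear_combination (condOpen E w F x e - 1 + (condOpen E w F y e - m)) * e2
      - (condOpen E w F y e - m) * e1

/-- Monotonicity for `t.compl` bounds the increment for `t` from above, because the two increments
sum to that of the conditional mean of `f`. -/
theorem coupled_sub_le (hw : IsLatticeWeight E w) (hf : ∀ a, 0 ≤ f a) (hmono : IncreasingOn E f)
    (t : DecisionTree ι) {F x y z : Finset ι} (h : WellFormed E F t) (hF : F ⊆ E) (hx : x ⊆ F)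
    (hyz : y ⊆ z) (hz : z ⊆ F) :
    t.coupled E w f F x z - t.coupled E w f F x y ≤
      mean E (fiber w F z) f - mean E (fiber w F y) f := by
  rw [← coupled_add_compl hw t h hF hx hz, ← coupled_add_compl hw t h hF hx (hyz.trans hz)]
  linarith [coupled_mono hw hf hmono t.compl h.compl hF hx hyz hz]

theorem mem_of_fiber_insert {F x a : Finset ι} {e : ι}
    (h : fiber w (insert e F) (insert e x) a ≠ 0) : e ∈ a := by
  have := inter_eq_of_fiber_ne_zero h
  exact (Finset.mem_inter.1 (this ▸ Finset.mem_insert_self e x : e ∈ a ∩ insert e F)).1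

theorem notMem_of_fiber_insert {F x a : Finset ι} {e : ι} (hex : e ∉ x)
    (h : fiber w (insert e F) x a ≠ 0) : e ∉ a := fun hea => by
  have := inter_eq_of_fiber_ne_zero h
  exact hex (this ▸ Finset.mem_inter.2 ⟨hea, Finset.mem_insert_self _ _⟩)

/-- With equal pasts the conditional probabilities agree, so `X` and `Y` never separate along the
tree. -/
theorem coupled_self (hw : IsLatticeWeight E w) :
    ∀ (t : DecisionTree ι) {F x : Finset ι}, WellFormed E F t → F ⊆ E → x ⊆ F →
      t.coupled E w f F x x = mean E (fiber w F x) (fun a => t.eval a * f a)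
  | leaf c, _, _, _, _, _ => by simp only [coupled, eval, mean_const_mul]
  | node e t₀ t₁, F, x, h, hF, hx => by
    have hF' : insert e F ⊆ E := Finset.insert_subset h.1 hF
    have hx' : x ⊆ insert e F := hx.trans (Finset.subset_insert e F)
    have hx1 : insert e x ⊆ insert e F := Finset.insert_subset_insert e hx
    have i1 := coupled_self hw t₁ h.2.2.2 hF' hx1
    have i0 := coupled_self hw t₀ h.2.2.1 hF' hx'
    rw [mean_fiber_split hw hF hx h.1 h.2.1]
    have k1 : mean E (fiber w (insert e F) (insert e x)) (fun a => (node e t₀ t₁).eval a * f a) =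
        t₁.coupled E w f (insert e F) (insert e x) (insert e x) := by
      rw [i1]
      exact mean_congr fun a _ h0 => by rw [eval, if_pos (mem_of_fiber_insert h0)]
    have k0 : mean E (fiber w (insert e F) x) (fun a => (node e t₀ t₁).eval a * f a) =
        t₀.coupled E w f (insert e F) x x := by
      rw [i0]
      exact mean_congr fun a _ h0 => by
        rw [eval, if_neg (notMem_of_fiber_insert (fun h' => h.2.1 (hx h')) h0)]
    rw [k1, k0, coupled, min_self]
    ring

theorem expectedCost_eq (hw : IsLatticeWeight E w) (C : ι → ℝ) :
    ∀ (t : DecisionTree ι) {F x : Finset ι}, WellFormed E F t → F ⊆ E → x ⊆ F →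
      t.expectedCost E w C F x = mean E (fiber w F x) (fun a => ∑ e ∈ t.queried a, C e)
  | leaf c, F, x, _, hF, hx => by
    simp only [expectedCost, queried, Finset.sum_empty]
    rw [mean_const (sum_fiber_pos hw hF hx)]
  | node e t₀ t₁, F, x, h, hF, hx => by
    have hF' : insert e F ⊆ E := Finset.insert_subset h.1 hF
    have hx' : x ⊆ insert e F := hx.trans (Finset.subset_insert e F)
    have hx1 : insert e x ⊆ insert e F := Finset.insert_subset_insert e hx
    have i1 := expectedCost_eq hw C t₁ h.2.2.2 hF' hx1
    have i0 := expectedCost_eq hw C t₀ h.2.2.1 hF' hx'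
    rw [mean_fiber_split hw hF hx h.1 h.2.1]
    have k1 : mean E (fiber w (insert e F) (insert e x))
        (fun a => ∑ e' ∈ (node e t₀ t₁).queried a, C e') =
        C e + t₁.expectedCost E w C (insert e F) (insert e x) := by
      rw [i1, ← mean_const (sum_fiber_pos hw hF' hx1) (C e), ← mean_add]
      refine mean_congr fun a _ h0 => ?_
      rw [queried, if_pos (mem_of_fiber_insert h0), Finset.sum_insert
        (disjoint_queried a h.2.2.2 e (Finset.mem_insert_self _ _))]
    have k0 : mean E (fiber w (insert e F) x)
        (fun a => ∑ e' ∈ (node e t₀ t₁).queried a, C e') =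
        C e + t₀.expectedCost E w C (insert e F) x := by
      rw [i0, ← mean_const (sum_fiber_pos hw hF' hx') (C e), ← mean_add]
      refine mean_congr fun a _ h0 => ?_
      rw [queried, if_neg (notMem_of_fiber_insert (fun h' => h.2.1 (hx h')) h0), Finset.sum_insert
        (disjoint_queried a h.2.2.1 e (Finset.mem_insert_self _ _))]
    rw [k1, k0, expectedCost]
    ring

/-- The covariance of `f` with the state of an edge, conditionally on `F` and then averaged, is at
most the unconditional one. -/
theorem mean_condCov_le (hw : IsLatticeWeight E w) (hf : ∀ a, 0 ≤ f a) (hmono : IncreasingOn E f)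
    {F : Finset ι} (hF : F ⊆ E) {e : ι} (heE : e ∈ E) (he : e ∉ F) :
    mean E w (fun a => condOpen E w F (a ∩ F) e * (1 - condOpen E w F (a ∩ F) e) *
      (mean E (fiber w (insert e F) (insert e (a ∩ F))) f -
        mean E (fiber w (insert e F) (a ∩ F)) f)) ≤ cov E w f (openAt e) := by
  set Φ : Finset ι → ℝ := fun a => mean E (fiber w F (a ∩ F)) f with hΦ
  set Ψ : Finset ι → ℝ := fun a => condOpen E w F (a ∩ F) e with hΨ
  have mono : ∀ g : Finset ι → ℝ, (∀ a, 0 ≤ g a) → IncreasingOn E g →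
      IncreasingOn E (fun a => mean E (fiber w F (a ∩ F)) g) := fun g hg hgm a b hab _ =>
    mean_fiber_mono hw hF (Finset.inter_subset_inter_right hab) Finset.inter_subset_right hg hgm
  -- Law of total covariance: the unconditional covariance is the averaged conditional one plus the
  -- covariance of the two conditional expectations, and FKG makes the latter nonnegative.
  have fkg := hw.cov_nonneg (f := Φ) (g := Ψ)
    (fun a => mean_nonneg (fiber_nonneg hw _ _) hf) (fun a => condOpen_nonneg hw _ _ _)
    (mono f hf hmono) (mono _ (openAt_nonneg e) (openAt_increasing e))
  have e1 : mean E w Φ = mean E w f := mean_mean_fiber hw hF f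
  have e2 : mean E w Ψ = mean E w (openAt e) := mean_mean_fiber hw hF (openAt e)
  rw [cov, e1, e2] at fkg
  have e3 : mean E w (fun a => f a * openAt e a) =
      mean E w (fun a => condOpen E w F (a ∩ F) e *
        mean E (fiber w (insert e F) (insert e (a ∩ F))) f) := by
    rw [← mean_mean_fiber hw hF (fun a => f a * openAt e a)]
    congr 1
    ext a
    have hx : a ∩ F ⊆ F := Finset.inter_subset_right
    rw [mean_fiber_split hw hF hx heE he]
    have k1 : mean E (fiber w (insert e F) (insert e (a ∩ F))) (fun a => f a * openAt e a) =
        mean E (fiber w (insert e F) (insert e (a ∩ F))) f :=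
      mean_congr fun b _ h0 => by rw [openAt, if_pos (mem_of_fiber_insert h0), mul_one]
    have k0 : mean E (fiber w (insert e F) (a ∩ F)) (fun a => f a * openAt e a) = 0 := by
      rw [mean_congr (g := fun _ => 0) fun b _ h0 => by
        rw [openAt, if_neg (notMem_of_fiber_insert (fun h' => he (hx h')) h0), mul_zero]]
      exact mean_const (sum_fiber_pos hw (Finset.insert_subset heE hF)
        (hx.trans (Finset.subset_insert e F))) 0
    rw [k1, k0]; ring
  have e4 : mean E w (fun a => condOpen E w F (a ∩ F) e * (1 - condOpen E w F (a ∩ F) e) *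
      (mean E (fiber w (insert e F) (insert e (a ∩ F))) f -
        mean E (fiber w (insert e F) (a ∩ F)) f)) + mean E w (fun a => Φ a * Ψ a) =
      mean E w (fun a => f a * openAt e a) := by
    rw [e3, ← mean_add]
    congr 1
    ext a
    simp only [hΦ, hΨ]
    rw [mean_fiber_split hw hF (Finset.inter_subset_right : a ∩ F ⊆ F) heE he]
    ring
  rw [cov, ← e4]
  linarith

/-- The expectation of the value of the tree, conditionally on the trace `x` on `F`. -/
theorem mean_fiber_eval_node (hw : IsLatticeWeight E w) {t₀ t₁ : DecisionTree ι} {e : ι}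
    {F x : Finset ι} (h : WellFormed E F (node e t₀ t₁)) (hF : F ⊆ E) (hx : x ⊆ F) :
    mean E (fiber w F x) (node e t₀ t₁).eval =
      condOpen E w F x e * mean E (fiber w (insert e F) (insert e x)) t₁.eval +
        (1 - condOpen E w F x e) * mean E (fiber w (insert e F) x) t₀.eval := by
  rw [mean_fiber_split hw hF hx h.1 h.2.1]
  congr 2
  · exact mean_congr fun a _ h0 => by rw [eval, if_pos (mem_of_fiber_insert h0)]
  · exact mean_congr fun a _ h0 => by
      rw [eval, if_neg (notMem_of_fiber_insert (fun h' => h.2.1 (hx h')) h0)]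

/-- This is the hybrid argument behind OSSS. The past of `Y` has its unconditional law,
independently of the past `x` of `X`, and the coupling starts only after `F`. Decoupling one queried
edge costs at most the covariance of `f` with that edge; at a leaf everything is independent and the
left side vanishes. At `F = ∅` it is the covariance of `f` with the tree. -/
theorem mean_coupled_sub_le (hw : IsLatticeWeight E w) (hf : ∀ a, 0 ≤ f a)
    (hmono : IncreasingOn E f) :
    ∀ (t : DecisionTree ι) {F x : Finset ι}, WellFormed E F t → F ⊆ E → x ⊆ F →
      mean E w (fun a => t.coupled E w f F x (a ∩ F)) -
        mean E w f * mean E (fiber w F x) t.eval ≤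
      t.expectedCost E w (fun e => cov E w f (openAt e)) F x
  | leaf c, F, x, h, hF, hx => by
    have e1 : mean E (fiber w F x) (leaf c : DecisionTree ι).eval = c :=
      mean_const (sum_fiber_pos hw hF hx) c
    simp only [coupled, expectedCost, mean_const_mul, e1]
    rw [mean_mean_fiber hw hF f]
    linarith
  | node e t₀ t₁, F, x, h, hF, hx => by
    have hF' : insert e F ⊆ E := Finset.insert_subset h.1 hF
    have hx' : x ⊆ insert e F := hx.trans (Finset.subset_insert e F)
    have hx1 : insert e x ⊆ insert e F := Finset.insert_subset_insert e hx
    have i1 := mean_coupled_sub_le hw hf hmono t₁ h.2.2.2 hF' hx1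
    have i0 := mean_coupled_sub_le hw hf hmono t₀ h.2.2.1 hF' hx'
    rw [mean_comp_inter_insert hw hF h.1 h.2.1
      (fun y => t₁.coupled E w f (insert e F) (insert e x) y)] at i1
    rw [mean_comp_inter_insert hw hF h.1 h.2.1
      (fun y => t₀.coupled E w f (insert e F) x y)] at i0
    have cv := mean_condCov_le hw hf hmono hF h.1 h.2.1
    rw [mean_fiber_eval_node hw h hF hx, expectedCost]
    set α := condOpen E w F x e
    have a0 : 0 ≤ α := condOpen_nonneg hw F x e
    have a1 : α ≤ 1 := condOpen_le_one hw hF hx e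
    have main : mean E w (fun a => (node e t₀ t₁).coupled E w f F x (a ∩ F)) ≤
        cov E w f (openAt e) +
        (α * mean E w (fun a => condOpen E w F (a ∩ F) e *
            t₁.coupled E w f (insert e F) (insert e x) (insert e (a ∩ F)) +
            (1 - condOpen E w F (a ∩ F) e) *
            t₁.coupled E w f (insert e F) (insert e x) (a ∩ F)) +
          (1 - α) * mean E w (fun a => condOpen E w F (a ∩ F) e *
            t₀.coupled E w f (insert e F) x (insert e (a ∩ F)) +
            (1 - condOpen E w F (a ∩ F) e) * t₀.coupled E w f (insert e F) x (a ∩ F))) := by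
      rw [← mean_const_mul, ← mean_const_mul, ← mean_add]
      refine le_trans ?_ (add_le_add_left cv _)
      rw [← mean_add]
      refine mean_le_mean hw.nonneg fun a _ _ => ?_
      have hy : a ∩ F ⊆ F := Finset.inter_subset_right
      set y := a ∩ F
      have hyy : y ⊆ insert e y := Finset.subset_insert e y
      have hy1 : insert e y ⊆ insert e F := Finset.insert_subset_insert e hy
      have d1 := coupled_sub_le hw hf hmono t₁ h.2.2.2 hF' hx1 hyy hy1
      have d0 := coupled_mono hw hf hmono t₀ h.2.2.1 hF' hx' hyy hy1
      have d2 := mean_fiber_mono hw hF' hyy hy1 hf hmono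
      have b0 : 0 ≤ condOpen E w F y e := condOpen_nonneg hw F y e
      have b1 : condOpen E w F y e ≤ 1 := condOpen_le_one hw hF hy e
      rw [coupled]
      change min α _ * _ + (α - min α _) * _ + ((_ - min α _) * _ + (1 - α - (_ - min α _)) * _) ≤ _
      set β := condOpen E w F y e
      set A := t₁.coupled E w f (insert e F) (insert e x) (insert e y)
      set B := t₁.coupled E w f (insert e F) (insert e x) y
      set C := t₀.coupled E w f (insert e F) x (insert e y)
      set D := t₀.coupled E w f (insert e F) x y
      set M1 := mean E (fiber w (insert e F) (insert e y)) f
      set M0 := mean E (fiber w (insert e F) y) f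
      -- The monotone coupling and the independent one differ by `(min α β - α * β) * ((A - B) - (C
      -- - D))`. The first factor, the covariance of the coupled bits, is at most the variance `β *
      -- (1 - β)` of the bit of `Y`, whatever `α` is.
      have k0 : 0 ≤ min α β - α * β := by
        rcases min_cases α β with hm | hm <;> rw [hm.1] <;> nlinarith
      have k1 : min α β - α * β ≤ β * (1 - β) := by
        rcases min_cases α β with hm | hm <;> rw [hm.1] <;> nlinarith
      have k2 : (min α β - α * β) * (A - B) ≤ (min α β - α * β) * (M1 - M0) :=
        mul_le_mul_of_nonneg_left d1 k0
      have k3 : (min α β - α * β) * (M1 - M0) ≤ β * (1 - β) * (M1 - M0) :=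
        mul_le_mul_of_nonneg_right k1 (sub_nonneg.2 d2)
      have k4 : 0 ≤ (min α β - α * β) * (C - D) := mul_nonneg k0 (sub_nonneg.2 d0)
      linarith
    have j1 := mul_le_mul_of_nonneg_left i1 a0
    have j0 := mul_le_mul_of_nonneg_left i0 (sub_nonneg.2 a1)
    linarith

/-- The OSSS inequality for weights satisfying the FKG lattice condition: the covariance of an
increasing function with the output of a decision tree is at most the expected sum, over the edges
queried by the tree, of the covariances of the function with the states of these edges. -/
theorem cov_eval_le (hw : IsLatticeWeight E w) (hf : ∀ a, 0 ≤ f a) (hmono : IncreasingOn E f)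
    {t : DecisionTree ι} (h : WellFormed E ∅ t) :
    cov E w f t.eval ≤ mean E w (fun a => ∑ e ∈ t.queried a, cov E w f (openAt e)) := by
  have h1 := mean_coupled_sub_le hw hf hmono t h (Finset.empty_subset E) subset_rfl
  have h2 := expectedCost_eq hw (fun e => cov E w f (openAt e)) t h (Finset.empty_subset E)
    subset_rfl
  have h3 := coupled_self (f := f) hw t h (Finset.empty_subset E) subset_rfl
  simp only [fiber_empty, Finset.inter_empty] at h1 h2 h3
  rw [mean_const hw.sum_pos, h3, h2] at h1
  rw [cov]
  simpa only [mul_comm] using h1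

/-- A tree that explores the edges `e` of `E₀` with `P x e`, where `x` is the set of open edges
found so far, until there are no such unexplored edges. -/
theorem exists_exploration (E₀ : Finset ι) (P : Finset ι → ι → Prop)
    (hP : ∀ x y e, x ⊆ y → P x e → P y e) (g : Finset ι → ℝ) (hg : ∀ a, 0 ≤ g a ∧ g a ≤ 1) :
    ∀ (k : ℕ) (F x : Finset ι), (E₀ \ F).card = k → F ⊆ E₀ → x ⊆ F →
      ∃ t : DecisionTree ι, WellFormed E₀ F t ∧ ∀ a, a ∩ F = x → ∃ F', F ⊆ F' ∧ F' ⊆ E₀ ∧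
        t.eval a = g (a ∩ F') ∧ (∀ e ∈ t.queried a, P a e) ∧
        ∀ e ∈ E₀, e ∉ F' → ¬ P (a ∩ F') e := by
  intro k
  induction k with
  | zero =>
    intro F x hk hF hx
    refine ⟨leaf (g x), hg x, fun a ha => ⟨F, subset_rfl, hF, by rw [ha, eval], ?_, ?_⟩⟩
    · simp [queried]
    · intro e he heF
      rw [Finset.card_eq_zero, Finset.sdiff_eq_empty_iff_subset] at hk
      exact absurd (hk he) heF
  | succ k ih =>
    intro F x hk hF hx
    by_cases hex : ∃ e ∈ E₀, e ∉ F ∧ P x e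
    · obtain ⟨e, he, heF, hPe⟩ := hex
      have hcard : (E₀ \ insert e F).card = k := by
        rw [Finset.sdiff_insert, Finset.card_erase_of_mem (Finset.mem_sdiff.2 ⟨he, heF⟩), hk]
        rfl
      have hF' : insert e F ⊆ E₀ := Finset.insert_subset he hF
      obtain ⟨t₀, w0, h0⟩ := ih (insert e F) x hcard hF' (hx.trans (Finset.subset_insert e F))
      obtain ⟨t₁, w1, h1⟩ := ih (insert e F) (insert e x) hcard hF'
        (Finset.insert_subset_insert e hx)
      refine ⟨node e t₀ t₁, ⟨he, heF, w0, w1⟩, fun a ha => ?_⟩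
      -- The query was triggered by the open edges found so far, a subset of `a`; monotonicity of
      -- `P` makes the criterion hold for `a` itself, so revealment is bounded by an event on the
      -- full configuration.
      have hPa : P a e := hP x a e (ha ▸ Finset.inter_subset_left) hPe
      by_cases hea : e ∈ a
      · obtain ⟨F', a1, a2, a3, a4, a5⟩ := h1 a (by rw [Finset.inter_insert_of_mem hea, ha])
        refine ⟨F', (Finset.subset_insert e F).trans a1, a2, by rw [eval, if_pos hea, a3], ?_, a5⟩
        rw [queried, if_pos hea]
        simpa using ⟨hPa, a4⟩
      · obtain ⟨F', a1, a2, a3, a4, a5⟩ := h0 a (by rw [Finset.inter_insert_of_notMem hea, ha])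
        refine ⟨F', (Finset.subset_insert e F).trans a1, a2, by rw [eval, if_neg hea, a3], ?_, a5⟩
        rw [queried, if_neg hea]
        simpa using ⟨hPa, a4⟩
    · push Not at hex
      refine ⟨leaf (g x), hg x, fun a ha => ⟨F, subset_rfl, hF, by rw [ha, eval], ?_, ?_⟩⟩
      · simp [queried]
      · intro e he heF
        rw [ha]
        exact hex e he heF

theorem queried_subset (a : Finset ι) : ∀ {t : DecisionTree ι} {F : Finset ι},
    WellFormed E F t → t.queried a ⊆ E
  | leaf _, _, _ => by simp [queried]
  | node e t₀ t₁, F, h => by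
    rw [queried]
    refine Finset.insert_subset h.1 ?_
    split_ifs
    exacts [queried_subset a h.2.2.2, queried_subset a h.2.2.1]

end DecisionTree

open Classical in
/-- The OSSS inequality for the exploration of the edges of `E₀` satisfying `P`: if it always
determines the increasing function `g`, then the variance of `g` is bounded. -/
theorem variance_le_of_exploration {E E₀ : Finset ι} {w : Finset ι → ℝ} (hw : IsLatticeWeight E w)
    (hE₀ : E₀ ⊆ E) (P : Finset ι → ι → Prop) (hP : ∀ x y e, x ⊆ y → P x e → P y e)
    (g : Finset ι → ℝ) (hg : ∀ a, 0 ≤ g a ∧ g a ≤ 1) (hmono : IncreasingOn E g)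
    (hdet : ∀ a F, a ⊆ E → F ⊆ E₀ → (∀ e ∈ E₀, e ∉ F → ¬ P (a ∩ F) e) → g (a ∩ F) = g a) :
    cov E w g g ≤
      ∑ e ∈ E₀, mean E w (fun a => if P a e then 1 else 0) * cov E w g (openAt e) := by
  obtain ⟨t, wt, ht⟩ := DecisionTree.exists_exploration E₀ P hP g hg _ ∅ ∅ rfl
    (Finset.empty_subset _) subset_rfl
  have heval : ∀ a, a ⊆ E → t.eval a = g a := fun a ha => by
    obtain ⟨F', -, h2, h3, -, h5⟩ := ht a (Finset.inter_empty a)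
    rw [h3, hdet a F' ha h2 h5]
  have osss := DecisionTree.cov_eval_le hw (fun a => (hg a).1) hmono (wt.mono hE₀)
  have e1 : cov E w g t.eval = cov E w g g := by
    rw [cov, cov, mean_congr (f := t.eval) (g := g) fun a ha _ => heval a ha,
      mean_congr (f := fun a => g a * t.eval a) (g := fun a => g a * g a)
        fun a ha _ => by rw [heval a ha]]
  rw [e1] at osss
  refine osss.trans ?_
  have hc : ∀ e, 0 ≤ cov E w g (openAt e) := fun e =>
    hw.cov_nonneg (fun a => (hg a).1) (openAt_nonneg e) hmono (openAt_increasing e)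
  have e2 : ∑ e ∈ E₀, mean E w (fun a => if P a e then 1 else 0) * cov E w g (openAt e) =
      mean E w (fun a => ∑ e ∈ E₀, cov E w g (openAt e) * (if P a e then 1 else 0)) := by
    rw [mean_sum]
    exact Finset.sum_congr rfl fun e _ => by rw [mean_const_mul, mul_comm]
  rw [e2]
  refine mean_le_mean hw.nonneg fun a _ _ => ?_
  obtain ⟨F', -, -, -, h4, -⟩ := ht a (Finset.inter_empty a)
  simp only [mul_ite, mul_one, mul_zero]
  rw [← Finset.sum_filter]
  refine Finset.sum_le_sum_of_subset_of_nonneg (fun e he => ?_) fun e _ _ => hc e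
  exact Finset.mem_filter.2 ⟨DecisionTree.queried_subset a wt he, h4 e he⟩

end DecisionTrees

/-! ### Supermodularity of the number of wired clusters, by dimension counting. -/

section Components

open scoped Classical

variable {V : Type u} {G : SimpleGraph V}

theorem mem_edgesIn {Λ : Finset V} {e : G.edgeSet} :
    e ∈ edgesIn G Λ ↔ ∀ x ∈ (e : Sym2 V), x ∈ Λ := by
  rw [edgesIn, Finset.mem_subtype, Finset.mem_sym2_iff]

theorem edgesIn_mono {Λ Λ' : Finset V} (h : Λ ⊆ Λ') : edgesIn G Λ ⊆ edgesIn G Λ' :=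
  fun _ he => mem_edgesIn.2 fun x hx => h (mem_edgesIn.1 he x hx)

/-- The vertices that are identified with each other by the wiring of `Λ`: those outside `Λ` and
those of its boundary. -/
def wiredSet (G : SimpleGraph V) (Λ : Finset V) : Set V :=
  {x | x ∉ Λ ∨ x ∈ vertexBoundary G Λ}

theorem wiredSet_anti {Λ Λ' : Finset V} (h : Λ ⊆ Λ') : wiredSet G Λ' ⊆ wiredSet G Λ := by
  rintro x (hx | ⟨hx, y, hy, hxy⟩)
  · exact Or.inl fun h' => hx (h h')
  · by_cases hxΛ : x ∈ Λ
    · exact Or.inr ⟨hxΛ, y, fun h' => hy (h h'), hxy⟩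
    · exact Or.inl hxΛ

theorem mem_wiredSet_of_notMem_edgesIn {Λ : Finset V} {e : G.edgeSet} (he : e ∉ edgesIn G Λ)
    {x : V} (hx : x ∈ (e : Sym2 V)) : x ∈ wiredSet G Λ := by
  by_cases hxΛ : x ∈ Λ
  · rw [mem_edgesIn] at he
    push Not at he
    obtain ⟨y, hy, hyΛ⟩ := he
    have hne : x ≠ y := fun h => hyΛ (h ▸ hxΛ)
    have : (e : Sym2 V) = s(x, y) := ((Sym2.mem_and_mem_iff hne).1 ⟨hx, hy⟩)
    exact Or.inr ⟨hxΛ, y, hyΛ, by rw [← SimpleGraph.mem_edgeSet, ← this]; exact e.2⟩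
  · exact Or.inl hxΛ

/-- The real functions on `V` that are constant on the clusters of `b` and on the wired set
of `Λ`. -/
def clusterFunctions (G : SimpleGraph V) (Λ : Finset V) (b : Finset G.edgeSet) :
    Submodule ℝ (V → ℝ) where
  carrier := {f | (∀ x ∈ wiredSet G Λ, ∀ y ∈ wiredSet G Λ, f x = f y) ∧
    ∀ e ∈ b, ∀ x y, (e : Sym2 V) = s(x, y) → f x = f y}
  add_mem' {f g} hf hg := ⟨fun x hx y hy => by
    simp only [Pi.add_apply, hf.1 x hx y hy, hg.1 x hx y hy], fun e he x y h => by
    simp only [Pi.add_apply, hf.2 e he x y h, hg.2 e he x y h]⟩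
  zero_mem' := ⟨fun _ _ _ _ => rfl, fun _ _ _ _ _ => rfl⟩
  smul_mem' c f hf := ⟨fun x hx y hy => by
    simp only [Pi.smul_apply, hf.1 x hx y hy], fun e he x y h => by
    simp only [Pi.smul_apply, hf.2 e he x y h]⟩

/-- The extension to `V` of a function of the wired clusters, with the value of the cluster of
`b₀` outside `Λ`. -/
def clusterExtension (Λ : Finset V) (b : Finset G.edgeSet) (b₀ : Λ) :
    ((wiredGraph G Λ b).ConnectedComponent → ℝ) →ₗ[ℝ] (V → ℝ) where
  toFun φ x := if h : x ∈ Λ then φ ((wiredGraph G Λ b).connectedComponentMk ⟨x, h⟩)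
    else φ ((wiredGraph G Λ b).connectedComponentMk b₀)
  map_add' φ ψ := by ext x; by_cases h : x ∈ Λ <;> simp [h]
  map_smul' c φ := by ext x; by_cases h : x ∈ Λ <;> simp [h]

theorem clusterExtension_injective (Λ : Finset V) (b : Finset G.edgeSet) (b₀ : Λ) :
    Function.Injective (clusterExtension Λ b b₀) := by
  intro φ ψ h
  ext C
  induction C using SimpleGraph.ConnectedComponent.ind with
  | h x =>
    have := congrFun h x
    simpa [clusterExtension] using this

/-- The complement of `Λ` takes the value of the wired cluster, which exists because the boundary is
nonempty; otherwise it would add a dimension. Working in `V → ℝ` rather than `Λ → ℝ` lets the spaces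
of different domains be compared. -/
theorem range_clusterExtension {Λ : Finset V} {b : Finset G.edgeSet} (hb : b ⊆ edgesIn G Λ)
    (b₀ : Λ) (hb₀ : (b₀ : V) ∈ vertexBoundary G Λ) :
    LinearMap.range (clusterExtension Λ b b₀) = clusterFunctions G Λ b := by
  ext f
  constructor
  · rintro ⟨φ, rfl⟩
    have wired : ∀ x ∈ wiredSet G Λ, clusterExtension Λ b b₀ φ x =
        φ ((wiredGraph G Λ b).connectedComponentMk b₀) := by
      rintro x (hx | hx)
      · simp [clusterExtension, hx]
      · have hxΛ : x ∈ Λ := hx.1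
        simp only [clusterExtension, LinearMap.coe_mk, AddHom.coe_mk, dif_pos hxΛ]
        congr 1
        rw [SimpleGraph.ConnectedComponent.eq]
        by_cases hxb : (⟨x, hxΛ⟩ : Λ) = b₀
        · rw [hxb]
        · refine SimpleGraph.Adj.reachable ?_
          rw [wiredGraph, SimpleGraph.fromRel_adj]
          exact ⟨hxb, Or.inl (Or.inr ⟨hx, hb₀⟩)⟩
    refine ⟨fun x hx y hy => by rw [wired x hx, wired y hy], fun e he x y hxy => ?_⟩
    have heΛ := mem_edgesIn.1 (hb he)
    have hx : x ∈ Λ := heΛ x (by rw [hxy]; exact Sym2.mem_mk_left x y)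
    have hy : y ∈ Λ := heΛ y (by rw [hxy]; exact Sym2.mem_mk_right x y)
    simp only [clusterExtension, LinearMap.coe_mk, AddHom.coe_mk, dif_pos hx, dif_pos hy]
    congr 1
    rw [SimpleGraph.ConnectedComponent.eq]
    refine SimpleGraph.Adj.reachable ?_
    rw [wiredGraph, SimpleGraph.fromRel_adj]
    refine ⟨fun h => ?_, Or.inl (Or.inl ⟨e, he, hxy⟩)⟩
    have hadj : G.Adj x y := by rw [← SimpleGraph.mem_edgeSet, ← hxy]; exact e.2
    exact hadj.ne (congrArg Subtype.val h)
  · rintro ⟨h1, h2⟩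
    have key : ∀ x y : Λ, (wiredGraph G Λ b).Adj x y → f x = f y := by
      intro x y hxy
      rw [wiredGraph, SimpleGraph.fromRel_adj] at hxy
      rcases hxy.2 with (⟨e, he, h⟩ | ⟨hx, hy⟩) | (⟨e, he, h⟩ | ⟨hx, hy⟩)
      · exact h2 e he _ _ h
      · exact h1 _ (Or.inr hx) _ (Or.inr hy)
      · exact (h2 e he _ _ h).symm
      · exact h1 _ (Or.inr hy) _ (Or.inr hx)
    have key' : ∀ x y : Λ, (wiredGraph G Λ b).Reachable x y → f x = f y := by
      intro x y hxy
      obtain ⟨p⟩ := hxy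
      induction p with
      | nil => rfl
      | cons h _ ih => exact (key _ _ h).trans ih
    refine ⟨fun C => C.lift (fun x : Λ => f x) fun x y p _ => key' x y ⟨p⟩, ?_⟩
    ext x
    by_cases hx : x ∈ Λ
    · simp [clusterExtension, hx]
    · simp only [clusterExtension, LinearMap.coe_mk, AddHom.coe_mk, dif_neg hx,
        SimpleGraph.ConnectedComponent.lift_mk]
      exact h1 _ (Or.inr hb₀) _ (Or.inl hx)

theorem finrank_clusterFunctions {Λ : Finset V} {b : Finset G.edgeSet} (hb : b ⊆ edgesIn G Λ)
    (hΛ : (vertexBoundary G Λ).Nonempty) :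
    FiniteDimensional ℝ (clusterFunctions G Λ b) ∧
      Module.finrank ℝ (clusterFunctions G Λ b) = wiredComponents G Λ b := by
  obtain ⟨b₀, hb₀⟩ := hΛ
  have : Finite (wiredGraph G Λ b).ConnectedComponent := Quot.finite _
  have := Fintype.ofFinite (wiredGraph G Λ b).ConnectedComponent
  rw [← range_clusterExtension hb ⟨b₀, hb₀.1⟩ hb₀]
  refine ⟨inferInstance, ?_⟩
  rw [LinearMap.finrank_range_of_inj (clusterExtension_injective Λ b _), wiredComponents,
    Module.finrank_fintype_fun_eq_card, Nat.card_eq_fintype_card]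

/-- The number of wired clusters is supermodular, also when two domains are compared. -/
theorem wiredComponents_add_le {Λ Λ' : Finset V} (hΛ : Λ ⊆ Λ')
    (hb : (vertexBoundary G Λ).Nonempty) (hb' : (vertexBoundary G Λ').Nonempty)
    {a b c d : Finset G.edgeSet} (ha : a ⊆ edgesIn G Λ') (hbΛ : b ⊆ edgesIn G Λ)
    (hd : d ⊆ edgesIn G Λ)
    (hca : c ⊆ a) (hc : ∀ e ∈ c, e ∈ b ∨ e ∉ edgesIn G Λ) (hd' : ∀ e ∈ d, e ∈ a ∨ e ∈ b) :
    wiredComponents G Λ' a + wiredComponents G Λ b ≤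
      wiredComponents G Λ' c + wiredComponents G Λ d := by
  obtain ⟨fa, ea⟩ := finrank_clusterFunctions ha hb'
  obtain ⟨fb, eb⟩ := finrank_clusterFunctions hbΛ hb
  obtain ⟨fc, ec⟩ := finrank_clusterFunctions (hca.trans ha) hb'
  obtain ⟨fd, ed⟩ := finrank_clusterFunctions hd hb
  -- Use `dim A + dim B = dim (A + B) + dim (A ∩ B)`: here `A + B` lies in the space of `c` and `A ∩
  -- B` in the space of `d`. An edge outside `edgesIn G Λ` has both endpoints in the wired set of
  -- `Λ`, hence imposes nothing new on `B`.
  rw [← ea, ← eb, ← ec, ← ed, ← Submodule.finrank_sup_add_finrank_inf_eq]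
  refine add_le_add (Submodule.finrank_mono (sup_le ?_ ?_)) (Submodule.finrank_mono ?_)
  · rintro f ⟨h1, h2⟩
    exact ⟨h1, fun e he => h2 e (hca he)⟩
  · rintro f ⟨h1, h2⟩
    refine ⟨fun x hx y hy => h1 x (wiredSet_anti hΛ hx) y (wiredSet_anti hΛ hy),
      fun e he x y hxy => ?_⟩
    rcases hc e he with h | h
    · exact h2 e h x y hxy
    · exact h1 x (mem_wiredSet_of_notMem_edgesIn h (by rw [hxy]; exact Sym2.mem_mk_left x y))
        y (mem_wiredSet_of_notMem_edgesIn h (by rw [hxy]; exact Sym2.mem_mk_right x y))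
  · rintro f ⟨⟨_, h2⟩, ⟨h1, h3⟩⟩
    refine ⟨h1, fun e he => ?_⟩
    rcases hd' e he with h | h
    · exact h2 e h
    · exact h3 e h

/-- A nonempty finite set of vertices of an infinite connected graph has a boundary. -/
theorem vertexBoundary_nonempty [Infinite V] (hG : G.Connected) {Λ : Finset V}
    (hΛ : Λ.Nonempty) : (vertexBoundary G Λ).Nonempty := by
  obtain ⟨x, hx⟩ := hΛ
  obtain ⟨y, hy⟩ := Infinite.exists_notMem_finset Λ
  obtain ⟨p⟩ := hG.preconnected x y
  obtain ⟨d, -, h1, h2⟩ := p.exists_boundary_dart (↑Λ) hx hy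
  exact ⟨d.fst, h1, d.snd, h2, d.adj⟩

end Components

/-- Opening all the edges of `E' \ E` identifies subsets of `E` with subsets of `E'`; wiring a
domain will be realised inside a larger one in this way. -/
theorem sum_powerset_extend {ι : Type*} [DecidableEq ι] {E E' : Finset ι} (h : E ⊆ E') (g : Finset ι → ℝ) :
    ∑ b ∈ E'.powerset, (if E' \ E ⊆ b then g (b ∩ E) else 0) = ∑ b ∈ E.powerset, g b := by
  rw [← Finset.sum_filter]
  refine Finset.sum_nbij' (fun b => b ∩ E) (fun b => b ∪ E' \ E) ?_ ?_ ?_ ?_ fun _ _ => rfl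
  · intro b _
    exact Finset.mem_powerset.2 Finset.inter_subset_right
  · intro b hb
    rw [Finset.mem_powerset] at hb
    exact Finset.mem_filter.2 ⟨Finset.mem_powerset.2
      (Finset.union_subset (hb.trans h) Finset.sdiff_subset), Finset.subset_union_right⟩
  · intro b hb
    rw [Finset.mem_filter, Finset.mem_powerset] at hb
    obtain ⟨hb1, hb2⟩ := hb
    ext e
    have h1 := @hb1 e
    have h2 := @hb2 e
    simp only [Finset.mem_union, Finset.mem_inter, Finset.mem_sdiff] at *
    tauto
  · intro b hb
    have hb' := Finset.mem_powerset.1 hb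
    ext e
    have := @hb' e
    simp only [Finset.mem_union, Finset.mem_inter, Finset.mem_sdiff] at *
    tauto

/-! ### Lattice condition for the random-cluster weights and monotonicity in the domain. -/

section Domains

open scoped Classical

variable {V : Type u} {G : SimpleGraph V} {p q : ℝ}

theorem wiredWeight_nonneg (hp : p ∈ Set.Icc (0 : ℝ) 1) (hq : 1 ≤ q) (Λ : Finset V)
    (a : Finset G.edgeSet) : 0 ≤ wiredWeight G p q Λ a :=
  mul_nonneg (mul_nonneg (pow_nonneg hp.1 _) (pow_nonneg (by linarith [hp.2]) _))
    (pow_nonneg (by linarith) _)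

theorem wiredWeight_pos (hp : p ∈ Set.Ioo (0 : ℝ) 1) (hq : 1 ≤ q) (Λ : Finset V)
    (a : Finset G.edgeSet) : 0 < wiredWeight G p q Λ a :=
  mul_pos (mul_pos (pow_pos hp.1 _) (pow_pos (by linarith [hp.2]) _)) (pow_pos (by linarith) _)

/-- The open and closed edges are equally many in total on both sides, so only the exponent of `q`
changes, and it increases by supermodularity. The case `Λ = Λ'` is the lattice condition; the
general case compares two domains. -/
theorem wiredWeight_mul_le (hp : p ∈ Set.Icc (0 : ℝ) 1) (hq : 1 ≤ q) {Λ Λ' : Finset V}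
    (hΛ : Λ ⊆ Λ') (hb : (vertexBoundary G Λ).Nonempty) (hb' : (vertexBoundary G Λ').Nonempty)
    {a b : Finset G.edgeSet} (ha : a ⊆ edgesIn G Λ') (hbΛ : b ⊆ edgesIn G Λ) :
    wiredWeight G p q Λ' a * wiredWeight G p q Λ b ≤
      wiredWeight G p q Λ' (a ∩ b ∪ a \ edgesIn G Λ) *
        wiredWeight G p q Λ (a ∩ edgesIn G Λ ∪ b) := by
  set E := edgesIn G Λ with hE
  set E' := edgesIn G Λ'
  set c := a ∩ b ∪ a \ E with hc
  set d := a ∩ E ∪ b with hd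
  have hca : c ⊆ a := Finset.union_subset Finset.inter_subset_left Finset.sdiff_subset
  have hdE : d ⊆ E := Finset.union_subset Finset.inter_subset_right hbΛ
  have hk := wiredComponents_add_le hΛ hb hb' ha hbΛ hdE hca (fun e he => by
      rcases Finset.mem_union.1 he with h | h
      · exact Or.inl (Finset.mem_inter.1 h).2
      · exact Or.inr (Finset.mem_sdiff.1 h).2) (fun e he => by
      rcases Finset.mem_union.1 he with h | h
      · exact Or.inl (Finset.mem_inter.1 h).1
      · exact Or.inr h)
  have c1 : a.card + b.card = c.card + d.card := by
    have h1 : c.card = (a ∩ b).card + (a \ E).card := by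
      refine Finset.card_union_of_disjoint (Finset.disjoint_left.2 fun e he he' => ?_)
      exact (Finset.mem_sdiff.1 he').2 (hbΛ (Finset.mem_inter.1 he).2)
    have h2 : d.card + ((a ∩ E) ∩ b).card = (a ∩ E).card + b.card :=
      Finset.card_union_add_card_inter _ _
    rw [Finset.inter_assoc, Finset.inter_eq_right.2 hbΛ] at h2
    have h3 := Finset.card_sdiff_add_card_inter a E
    omega
  have c2 : (E' \ a).card + (E \ b).card = (E' \ c).card + (E \ d).card := by
    have h1 := Finset.card_sdiff_add_card_eq_card ha
    have h2 := Finset.card_sdiff_add_card_eq_card hbΛ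
    have h3 := Finset.card_sdiff_add_card_eq_card (hca.trans ha)
    have h4 := Finset.card_sdiff_add_card_eq_card hdE
    omega
  have h1p : 0 ≤ 1 - p := by linarith [hp.2]
  calc wiredWeight G p q Λ' a * wiredWeight G p q Λ b
      = p ^ (a.card + b.card) * (1 - p) ^ ((E' \ a).card + (E \ b).card) *
        q ^ (wiredComponents G Λ' a + wiredComponents G Λ b) := by
        simp only [wiredWeight, pow_add]; ring
    _ ≤ p ^ (c.card + d.card) * (1 - p) ^ ((E' \ c).card + (E \ d).card) *
        q ^ (wiredComponents G Λ' c + wiredComponents G Λ d) := by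
        rw [c1, c2]
        exact mul_le_mul_of_nonneg_left (pow_le_pow_right₀ hq hk)
          (mul_nonneg (pow_nonneg hp.1 _) (pow_nonneg h1p _))
    _ = _ := by simp only [wiredWeight, pow_add]; ring

theorem isLatticeWeight (hp : p ∈ Set.Ioo (0 : ℝ) 1) (hq : 1 ≤ q) {Λ : Finset V}
    (hb : (vertexBoundary G Λ).Nonempty) :
    IsLatticeWeight (edgesIn G Λ) (wiredWeight G p q Λ) where
  nonneg := wiredWeight_nonneg ⟨hp.1.le, hp.2.le⟩ hq Λ
  pos a _ := wiredWeight_pos hp hq Λ a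
  lattice a b ha hbΛ := by
    have := wiredWeight_mul_le ⟨hp.1.le, hp.2.le⟩ hq subset_rfl hb hb ha hbΛ
    rwa [Finset.sdiff_eq_empty_iff_subset.2 ha, Finset.union_empty,
      Finset.inter_eq_left.2 ha] at this

/-- The expectation of `f` under the wired random-cluster measure in `Λ`. -/
def rcMean (G : SimpleGraph V) (p q : ℝ) (Λ : Finset V) (f : Finset G.edgeSet → ℝ) : ℝ :=
  mean (edgesIn G Λ) (wiredWeight G p q Λ) f

/-- The wired measures are stochastically decreasing in the domain. -/
theorem rcMean_anti (hp : p ∈ Set.Ioo (0 : ℝ) 1) (hq : 1 ≤ q) {Λ Λ' : Finset V}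
    (hΛ : Λ ⊆ Λ') (hb : (vertexBoundary G Λ).Nonempty) (hb' : (vertexBoundary G Λ').Nonempty)
    {f : Finset G.edgeSet → ℝ} (hf : ∀ a, 0 ≤ f a) (hmono : ∀ a b, a ⊆ b → f a ≤ f b)
    (hloc : ∀ a, f (a ∩ edgesIn G Λ) = f a) :
    rcMean G p q Λ' f ≤ rcMean G p q Λ f := by
  have hE := edgesIn_mono (G := G) hΛ
  set E := edgesIn G Λ with hEdef
  set E' := edgesIn G Λ' with hEdef'
  -- The wired measure in `Λ`, carried to the edges of `Λ'` with all the additional edges open;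
  -- Holley's condition between the two is `wiredWeight_mul_le`.
  set w₂ : Finset G.edgeSet → ℝ := fun b => if E' \ E ⊆ b then wiredWeight G p q Λ (b ∩ E) else 0
  have hp' : p ∈ Set.Icc (0 : ℝ) 1 := ⟨hp.1.le, hp.2.le⟩
  have s1 : ∑ b ∈ E'.powerset, w₂ b = ∑ b ∈ E.powerset, wiredWeight G p q Λ b :=
    sum_powerset_extend hE _
  have s2 : ∑ b ∈ E'.powerset, w₂ b * f b = ∑ b ∈ E.powerset, wiredWeight G p q Λ b * f b := by
    rw [← sum_powerset_extend hE]
    refine Finset.sum_congr rfl fun b _ => ?_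
    simp only [w₂]
    split_ifs
    · rw [hloc]
    · rw [zero_mul]
  have e : rcMean G p q Λ f = mean E' w₂ f := by
    rw [rcMean, mean, mean, s1, s2]
  rw [e]
  refine mean_le_mean_of_holley E' _ w₂ f (wiredWeight_nonneg hp' hq Λ') (fun b => ?_) hf
    (fun a b h _ => hmono a b h) (fun a b ha hbE => ?_) (isLatticeWeight hp hq hb').sum_pos ?_
  · simp only [w₂]
    split_ifs
    exacts [wiredWeight_nonneg hp' hq Λ _, le_rfl]
  · simp only [w₂]
    split_ifs with h1 h2 h2
    · have := wiredWeight_mul_le hp' hq hΛ hb hb' ha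
        (Finset.inter_subset_right : b ∩ edgesIn G Λ ⊆ edgesIn G Λ)
      have e1 : a ∩ (b ∩ edgesIn G Λ) ∪ a \ edgesIn G Λ = a ∩ b := by
        ext x
        have := @h1 x
        have := @ha x
        simp only [Finset.mem_union, Finset.mem_inter, Finset.mem_sdiff, ← hEdef] at *
        tauto
      rwa [e1, ← Finset.union_inter_distrib_right] at this
    · exact absurd (h1.trans Finset.subset_union_right) h2
    · rw [mul_zero]
      exact mul_nonneg (wiredWeight_nonneg hp' hq Λ' _) (wiredWeight_nonneg hp' hq Λ _)
    · simp
  · rw [s1]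
    exact (isLatticeWeight hp hq hb).sum_pos

end Domains

/-! ### Distances and finite balls. -/

section Balls

variable {V : Type u} {G : SimpleGraph V}

theorem dist_le_succ_of_adj (hc : G.Connected) (o : V) {x y : V} (h : G.Adj x y) :
    G.dist o y ≤ G.dist o x + 1 := by
  have := hc.dist_triangle (u := o) (v := x) (w := y)
  rwa [SimpleGraph.dist_eq_one_iff_adj.2 h] at this

theorem exists_adj_dist_eq (hc : G.Connected) {o x : V} {d : ℕ} (h : G.dist o x = d + 1) :
    ∃ y, G.Adj x y ∧ G.dist o y = d := by
  obtain ⟨w, hw⟩ := hc.exists_walk_length_eq_dist x o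
  rw [SimpleGraph.dist_comm, h] at hw
  cases w with
  | nil => simp at hw
  | @cons _ y _ hxy w =>
    rw [SimpleGraph.Walk.length_cons] at hw
    have h1 := SimpleGraph.dist_le w
    rw [SimpleGraph.dist_comm] at h1
    have h2 := dist_le_succ_of_adj hc o hxy.symm
    exact ⟨y, hxy, by omega⟩

theorem finite_closedBall (hc : G.Connected) (hl : ∀ x, (G.neighborSet x).Finite) (o : V) (n : ℕ) :
    (closedBall G o n).Finite := by
  induction n with
  | zero =>
    refine (Set.finite_singleton o).subset fun x hx => ?_
    have : G.dist o x = 0 := Nat.le_zero.1 hx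
    exact (hc.dist_eq_zero_iff.1 this).symm
  | succ n ih =>
    refine (ih.union (ih.biUnion fun x _ => hl x)).subset fun x hx => ?_
    by_cases h : G.dist o x ≤ n
    · exact Or.inl h
    · refine Or.inr ?_
      have hx' : G.dist o x = n + 1 := le_antisymm hx (by omega)
      obtain ⟨y, hxy, hy⟩ := exists_adj_dist_eq hc hx'
      exact Set.mem_biUnion (x := y) (show G.dist o y ≤ n from hy.le) hxy.symm

open Classical in
/-- The ball of radius `n` around `o`, as a finite set of vertices. -/
def ball (G : SimpleGraph V) (o : V) (n : ℕ) : Finset V :=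
  if h : (closedBall G o n).Finite then h.toFinset else ∅

theorem IsInfiniteTransitive.mem_ball (hG : IsInfiniteTransitive G) {o x : V} {n : ℕ} :
    x ∈ ball G o n ↔ G.dist o x ≤ n := by
  have h := finite_closedBall hG.connected hG.locallyFinite o n
  rw [ball, dif_pos h, Set.Finite.mem_toFinset]
  rfl

theorem IsInfiniteTransitive.center_mem_ball (hG : IsInfiniteTransitive G) (o : V) (n : ℕ) :
    o ∈ ball G o n := by
  rw [hG.mem_ball, SimpleGraph.dist_self]; exact Nat.zero_le n

theorem IsInfiniteTransitive.ball_subset_ball (hG : IsInfiniteTransitive G) {o x : V} {m n : ℕ}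
    (h : G.dist o x + m ≤ n) : ball G x m ⊆ ball G o n := fun y hy => by
  rw [hG.mem_ball] at hy ⊢
  exact (hG.connected.dist_triangle (v := x)).trans (by omega)

theorem IsInfiniteTransitive.boundary_ball (hG : IsInfiniteTransitive G) (o : V) (n : ℕ) :
    (vertexBoundary G (ball G o n)).Nonempty := by
  have := hG.infinite
  exact vertexBoundary_nonempty hG.connected ⟨o, hG.center_mem_ball o n⟩

end Balls

/-! ### The events of connection to a given distance. -/

section Connectivity

variable {V : Type u} {G : SimpleGraph V}

theorem openGraph_le (ω : Config G) : openGraph ω ≤ G := fun _ _ h => h.1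

theorem openGraph_mono {ω ω' : Config G} (h : ∀ e, ω e = true → ω' e = true) :
    openGraph ω ≤ openGraph ω' := fun _ _ ⟨h1, h2⟩ => ⟨h1, h _ h2⟩

/-- The event that `o` is connected by an open path to a vertex at distance at least `n`. -/
def reach (G : SimpleGraph V) (o : V) (n : ℕ) : Set (Config G) :=
  {ω | ∃ x, n ≤ G.dist o x ∧ (openGraph ω).Reachable o x}

theorem reach_mono {o : V} {n : ℕ} {ω ω' : Config G} (h : ∀ e, ω e = true → ω' e = true)
    (hω : ω ∈ reach G o n) : ω' ∈ reach G o n := by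
  obtain ⟨x, hx, hr⟩ := hω
  exact ⟨x, hx, hr.mono (openGraph_mono h)⟩

theorem reach_anti {o : V} {m n : ℕ} (h : m ≤ n) : reach G o n ⊆ reach G o m :=
  fun _ ⟨x, hx, hr⟩ => ⟨x, h.trans hx, hr⟩

/-- Induction on the vertices of the open cluster of `o`. -/
theorem reachable_induction {H : SimpleGraph V} {o : V} {P : V → Prop} (h0 : P o)
    (hs : ∀ x y, H.Reachable o x → P x → H.Adj x y → P y) {x : V} (h : H.Reachable o x) : P x := by
  rw [SimpleGraph.reachable_iff_reflTransGen] at h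
  induction h with
  | refl => exact h0
  | tail h1 h2 ih => exact hs _ _ ((SimpleGraph.reachable_iff_reflTransGen _ _).2 h1) ih h2

/-- Before an open path first attains distance `n` it stays at distance less than `n`, so up to that
moment all its edges lie in the ball of radius `n`. -/
theorem IsInfiniteTransitive.reach_of_agree (hG : IsInfiniteTransitive G) {o : V} {n : ℕ}
    {ω ω' : Config G} (h : ∀ e ∈ edgesIn G (ball G o n), ω e = true → ω' e = true)
    (hω : ω ∈ reach G o n) : ω' ∈ reach G o n := by
  obtain ⟨x, hx, hr⟩ := hω
  have key : ω' ∈ reach G o n ∨ (G.dist o x < n ∧ (openGraph ω').Reachable o x) := by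
    refine reachable_induction (P := fun x => ω' ∈ reach G o n ∨
      (G.dist o x < n ∧ (openGraph ω').Reachable o x)) ?_ ?_ hr
    · rcases Nat.eq_zero_or_pos n with h0 | h0
      · exact Or.inl ⟨o, by omega, SimpleGraph.Reachable.refl _⟩
      · exact Or.inr ⟨by rwa [SimpleGraph.dist_self], SimpleGraph.Reachable.refl _⟩
    · rintro x y - (hx | ⟨hx, hr⟩) ⟨hxy, hω⟩
      · exact Or.inl hx
      · have hy : G.dist o y ≤ G.dist o x + 1 := dist_le_succ_of_adj hG.connected o hxy
        have he : (⟨s(x, y), hxy⟩ : G.edgeSet) ∈ edgesIn G (ball G o n) := by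
          rw [mem_edgesIn]
          intro z hz
          rw [hG.mem_ball]
          rcases Sym2.mem_iff.1 hz with h' | h' <;> rw [h'] <;> omega
        have hr' : (openGraph ω').Reachable o y :=
          hr.trans (SimpleGraph.Adj.reachable ⟨hxy, h _ he hω⟩)
        rcases le_or_gt n (G.dist o y) with h' | h'
        · exact Or.inl ⟨y, h', hr'⟩
        · exact Or.inr ⟨h', hr'⟩
  rcases key with h' | ⟨h', -⟩
  · exact h'
  · omega

/-- An open cluster intersects all the spheres up to its radius. -/
theorem exists_reachable_dist_eq (hc : G.Connected) {H : SimpleGraph V} (hH : H ≤ G) {o x : V}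
    (h : H.Reachable o x) {k : ℕ} (hk : k ≤ G.dist o x) :
    ∃ z, G.dist o z = k ∧ H.Reachable o z := by
  refine reachable_induction (P := fun x => k ≤ G.dist o x →
    ∃ z, G.dist o z = k ∧ H.Reachable o z) ?_ ?_ h hk
  · intro hk
    rw [SimpleGraph.dist_self] at hk
    exact ⟨o, by rw [SimpleGraph.dist_self]; omega, SimpleGraph.Reachable.refl _⟩
  · intro x y hx ih hxy hk
    have := dist_le_succ_of_adj hc o (hH hxy)
    by_cases h' : k ≤ G.dist o x
    · exact ih h'
    · exact ⟨y, by omega, hx.trans hxy.reachable⟩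

end Connectivity

/-! ### Connection probabilities in wired balls. -/

section FiniteConfigurations

open scoped Classical

variable {V : Type u} {G : SimpleGraph V} {p q : ℝ}

/-- The configuration whose open edges are those of `a`. -/
def configOf (a : Finset G.edgeSet) : Config G := fun e => decide (e ∈ a)

theorem configOf_eq_true {a : Finset G.edgeSet} {e : G.edgeSet} :
    configOf a e = true ↔ e ∈ a := by
  simp [configOf]

theorem openGraph_configOf_adj {a : Finset G.edgeSet} {x y : V} :
    (openGraph (configOf a)).Adj x y ↔ ∃ e ∈ a, (e : Sym2 V) = s(x, y) := by
  constructor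
  · rintro ⟨h, h'⟩
    exact ⟨_, configOf_eq_true.1 h', rfl⟩
  · rintro ⟨e, he, h⟩
    refine ⟨h ▸ e.2, configOf_eq_true.2 ?_⟩
    convert he
    exact h.symm

/-- The indicator function of an event, on finite sets of open edges. -/
def eventFn (A : Set (Config G)) (a : Finset G.edgeSet) : ℝ :=
  if configOf a ∈ A then 1 else 0

theorem eventFn_nonneg (A : Set (Config G)) (a : Finset G.edgeSet) : 0 ≤ eventFn A a := by
  unfold eventFn; split_ifs <;> norm_num

theorem eventFn_le_one (A : Set (Config G)) (a : Finset G.edgeSet) : eventFn A a ≤ 1 := by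
  unfold eventFn; split_ifs <;> norm_num

theorem eventFn_le_eventFn {W : Type v} {H : SimpleGraph W} {A : Set (Config G)}
    {B : Set (Config H)} {a : Finset G.edgeSet} {b : Finset H.edgeSet}
    (h : configOf a ∈ A → configOf b ∈ B) : eventFn A a ≤ eventFn B b := by
  unfold eventFn
  split_ifs with h1 h2 h2
  · exact le_rfl
  · exact absurd (h h1) h2
  · norm_num
  · exact le_rfl

theorem eventFn_reach_mono (o : V) (n : ℕ) (a b : Finset G.edgeSet) (h : a ⊆ b) :
    eventFn (reach G o n) a ≤ eventFn (reach G o n) b :=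
  eventFn_le_eventFn (reach_mono fun _ he => configOf_eq_true.2 (h (configOf_eq_true.1 he)))

theorem IsInfiniteTransitive.eventFn_reach_inter (hG : IsInfiniteTransitive G) (o : V) (n : ℕ)
    (a : Finset G.edgeSet) :
    eventFn (reach G o n) (a ∩ edgesIn G (ball G o n)) = eventFn (reach G o n) a := by
  refine le_antisymm (eventFn_reach_mono o n _ _ Finset.inter_subset_left)
    (eventFn_le_eventFn (hG.reach_of_agree fun e he h => ?_))
  exact configOf_eq_true.2 (Finset.mem_inter.2 ⟨configOf_eq_true.1 h, he⟩)

/-- The probability that `o` is connected to distance `n` in the ball of radius `n` with wired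
boundary conditions. -/
def theta (G : SimpleGraph V) (p q : ℝ) (o : V) (n : ℕ) : ℝ :=
  rcMean G p q (ball G o n) (eventFn (reach G o n))

/-- Comparison of the connection probabilities in a domain and in a ball. -/
theorem IsInfiniteTransitive.rcMean_reach_le_theta (hG : IsInfiniteTransitive G)
    (hp : p ∈ Set.Ioo (0 : ℝ) 1) (hq : 1 ≤ q) {Λ : Finset V} {x : V} {m : ℕ}
    (h : ball G x m ⊆ Λ) : rcMean G p q Λ (eventFn (reach G x m)) ≤ theta G p q x m := by
  have := hG.infinite
  exact rcMean_anti hp hq h (hG.boundary_ball x m)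
    (vertexBoundary_nonempty hG.connected ⟨x, h (hG.center_mem_ball x m)⟩) (eventFn_nonneg _)
    (eventFn_reach_mono x m) (hG.eventFn_reach_inter x m)

theorem rcMean_le_rcMean (hp : p ∈ Set.Icc (0 : ℝ) 1) (hq : 1 ≤ q) {Λ : Finset V}
    {f g : Finset G.edgeSet → ℝ} (h : ∀ a, f a ≤ g a) : rcMean G p q Λ f ≤ rcMean G p q Λ g :=
  mean_le_mean (wiredWeight_nonneg hp hq Λ) fun a _ _ => h a

end FiniteConfigurations

/-! ### Invariance of finite-volume quantities under isomorphisms of domains. -/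

section Isomorphisms

open scoped Classical

variable {V : Type u} {W : Type v} {G : SimpleGraph V} {H : SimpleGraph W} {p q : ℝ}

/-- `f` and `g` are inverse isomorphisms between the subgraphs induced by `Λ` and `Λ'`, which
preserve the boundaries. -/
structure IsDomainIso (G : SimpleGraph V) (Λ : Finset V) (H : SimpleGraph W) (Λ' : Finset W)
    (f : V → W) (g : W → V) : Prop where
  maps : ∀ x ∈ Λ, f x ∈ Λ'
  maps' : ∀ y ∈ Λ', g y ∈ Λ
  left : ∀ x ∈ Λ, g (f x) = x
  right : ∀ y ∈ Λ', f (g y) = y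
  adj : ∀ x ∈ Λ, ∀ y ∈ Λ, G.Adj x y → H.Adj (f x) (f y)
  adj' : ∀ x ∈ Λ', ∀ y ∈ Λ', H.Adj x y → G.Adj (g x) (g y)
  boundary : ∀ x ∈ vertexBoundary G Λ, f x ∈ vertexBoundary H Λ'
  boundary' : ∀ y ∈ vertexBoundary H Λ', g y ∈ vertexBoundary G Λ

variable {Λ : Finset V} {Λ' : Finset W} {f : V → W} {g : W → V}

theorem IsDomainIso.symm (h : IsDomainIso G Λ H Λ' f g) : IsDomainIso H Λ' G Λ g f :=
  ⟨h.maps', h.maps, h.right, h.left, h.adj', h.adj, h.boundary', h.boundary⟩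

/-- The image of a set of edges under a map of the vertices. -/
def mapEdges (H : SimpleGraph W) (Λ' : Finset W) (f : V → W) (a : Finset G.edgeSet) :
    Finset H.edgeSet :=
  (edgesIn H Λ').filter fun e' => ∃ e ∈ a, (e' : Sym2 W) = Sym2.map f e

theorem mem_mapEdges {a : Finset G.edgeSet} {e' : H.edgeSet} : e' ∈ mapEdges H Λ' f a ↔
    e' ∈ edgesIn H Λ' ∧ ∃ e ∈ a, (e' : Sym2 W) = Sym2.map f e :=
  Finset.mem_filter

theorem IsDomainIso.map_mem (h : IsDomainIso G Λ H Λ' f g) {e : G.edgeSet}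
    (he : e ∈ edgesIn G Λ) :
    ∃ hm : Sym2.map f e ∈ H.edgeSet, (⟨_, hm⟩ : H.edgeSet) ∈ edgesIn H Λ' := by
  obtain ⟨e, hadj⟩ := e
  induction e with
  | h x y =>
    rw [mem_edgesIn] at he
    have hx : x ∈ Λ := he x (Sym2.mem_mk_left x y)
    have hy : y ∈ Λ := he y (Sym2.mem_mk_right x y)
    refine ⟨h.adj x hx y hy hadj, mem_edgesIn.2 fun z hz => ?_⟩
    rcases Sym2.mem_iff.1 hz with rfl | rfl
    exacts [h.maps x hx, h.maps y hy]

theorem IsDomainIso.map_map (h : IsDomainIso G Λ H Λ' f g) {e : G.edgeSet}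
    (he : e ∈ edgesIn G Λ) : Sym2.map g (Sym2.map f e) = e := by
  obtain ⟨e, hadj⟩ := e
  induction e with
  | h x y =>
    rw [mem_edgesIn] at he
    have hx : x ∈ Λ := he x (Sym2.mem_mk_left x y)
    have hy : y ∈ Λ := he y (Sym2.mem_mk_right x y)
    simp [h.left x hx, h.left y hy]

theorem IsDomainIso.mapEdges_mapEdges (h : IsDomainIso G Λ H Λ' f g) {a : Finset G.edgeSet}
    (ha : a ⊆ edgesIn G Λ) : mapEdges G Λ g (mapEdges H Λ' f a) = a := by
  ext e
  rw [mem_mapEdges]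
  constructor
  · rintro ⟨-, e', he', hee'⟩
    obtain ⟨-, e₁, he₁, h1⟩ := mem_mapEdges.1 he'
    rw [h1, h.map_map (ha he₁)] at hee'
    rwa [Subtype.ext hee']
  · intro he
    obtain ⟨hm, hm'⟩ := h.map_mem (ha he)
    exact ⟨ha he, _, mem_mapEdges.2 ⟨hm', e, he, rfl⟩, (h.map_map (ha he)).symm⟩

theorem mapEdges_subset (a : Finset G.edgeSet) : mapEdges H Λ' f a ⊆ edgesIn H Λ' :=
  Finset.filter_subset _ _

/-- Only an inequality is needed here: applied to the inverse isomorphism as well, it gives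
equality. -/
theorem IsDomainIso.card_mapEdges_le (h : IsDomainIso G Λ H Λ' f g) {a : Finset G.edgeSet}
    (ha : a ⊆ edgesIn G Λ) : a.card ≤ (mapEdges H Λ' f a).card := by
  refine Finset.card_le_card_of_forall_subsingleton 
    (r := fun (e : G.edgeSet) (e' : H.edgeSet) => (e' : Sym2 W) = Sym2.map f e)
    (fun e he => ?_) fun e' _ => ?_
  · obtain ⟨hm, hm'⟩ := h.map_mem (ha he)
    exact ⟨⟨_, hm⟩, mem_mapEdges.2 ⟨hm', e, he, rfl⟩, rfl⟩
  · rintro e₁ ⟨h1, h1'⟩ e₂ ⟨h2, h2'⟩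
    apply Subtype.ext
    rw [← h.map_map (ha h1), ← h.map_map (ha h2)]
    change (e' : Sym2 W) = _ at h1' h2'
    rw [← h1', h2']

theorem IsDomainIso.card_mapEdges (h : IsDomainIso G Λ H Λ' f g) {a : Finset G.edgeSet}
    (ha : a ⊆ edgesIn G Λ) : (mapEdges H Λ' f a).card = a.card := by
  refine le_antisymm ?_ (h.card_mapEdges_le ha)
  have := h.symm.card_mapEdges_le (mapEdges_subset (H := H) (Λ' := Λ') (f := f) a)
  rwa [h.mapEdges_mapEdges ha] at this

theorem IsDomainIso.mapEdges_edgesIn (h : IsDomainIso G Λ H Λ' f g) :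
    mapEdges H Λ' f (edgesIn G Λ) = edgesIn H Λ' := by
  refine Finset.Subset.antisymm (mapEdges_subset _) fun e' he' => mem_mapEdges.2 ⟨he', ?_⟩
  obtain ⟨hm, hm'⟩ := h.symm.map_mem he'
  exact ⟨_, hm', (h.symm.map_map he').symm⟩

theorem IsDomainIso.exists_mapEdges_iff (h : IsDomainIso G Λ H Λ' f g) {a : Finset G.edgeSet}
    (ha : a ⊆ edgesIn G Λ) {x y : V} (hx : x ∈ Λ) (hy : y ∈ Λ) :
    (∃ e ∈ mapEdges H Λ' f a, (e : Sym2 W) = s(f x, f y)) ↔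
      ∃ e ∈ a, (e : Sym2 V) = s(x, y) := by
  constructor
  · rintro ⟨e', he', h1⟩
    obtain ⟨-, e, he, h2⟩ := mem_mapEdges.1 he'
    refine ⟨e, he, ?_⟩
    rw [← h.map_map (ha he), ← h2, h1]
    simp [h.left x hx, h.left y hy]
  · rintro ⟨e, he, h1⟩
    obtain ⟨hm, hm'⟩ := h.map_mem (ha he)
    refine ⟨_, mem_mapEdges.2 ⟨hm', e, he, rfl⟩, ?_⟩
    simp [h1]

theorem IsDomainIso.mem_boundary_iff (h : IsDomainIso G Λ H Λ' f g) {x : V} (hx : x ∈ Λ) :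
    f x ∈ vertexBoundary H Λ' ↔ x ∈ vertexBoundary G Λ := by
  refine ⟨fun hb => ?_, h.boundary x⟩
  have := h.boundary' _ hb
  rwa [h.left x hx] at this

theorem IsDomainIso.wiredComponents_eq (h : IsDomainIso G Λ H Λ' f g) {a : Finset G.edgeSet}
    (ha : a ⊆ edgesIn G Λ) :
    wiredComponents H Λ' (mapEdges H Λ' f a) = wiredComponents G Λ a := by
  let σ : Λ ≃ Λ' :=
    { toFun := fun x => ⟨f x, h.maps x x.2⟩
      invFun := fun y => ⟨g y, h.maps' y y.2⟩
      left_inv := fun x => Subtype.ext (h.left x x.2)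
      right_inv := fun y => Subtype.ext (h.right y y.2) }
  have iso : wiredGraph G Λ a ≃g wiredGraph H Λ' (mapEdges H Λ' f a) :=
    { toEquiv := σ
      map_rel_iff' := by
        intro x y
        have hxy : σ x ≠ σ y ↔ x ≠ y := σ.injective.ne_iff
        have e1 : ((σ x : Λ') : W) = f x := rfl
        have e2 : ((σ y : Λ') : W) = f y := rfl
        rw [wiredGraph, wiredGraph, SimpleGraph.fromRel_adj, SimpleGraph.fromRel_adj, hxy, e1, e2,
          h.exists_mapEdges_iff ha x.2 y.2, h.exists_mapEdges_iff ha y.2 x.2,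
          h.mem_boundary_iff x.2, h.mem_boundary_iff y.2] }
  exact (Nat.card_congr iso.connectedComponentEquiv).symm

theorem IsDomainIso.wiredWeight_eq (h : IsDomainIso G Λ H Λ' f g) {a : Finset G.edgeSet}
    (ha : a ⊆ edgesIn G Λ) :
    wiredWeight H p q Λ' (mapEdges H Λ' f a) = wiredWeight G p q Λ a := by
  have c : (edgesIn H Λ' \ mapEdges H Λ' f a).card = (edgesIn G Λ \ a).card := by
    have h1 := Finset.card_sdiff_add_card_eq_card ha
    have h2 := Finset.card_sdiff_add_card_eq_card
      (mapEdges_subset (H := H) (Λ' := Λ') (f := f) a)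
    have h3 := h.card_mapEdges subset_rfl
    rw [h.mapEdges_edgesIn] at h3
    have h4 := h.card_mapEdges ha
    omega
  rw [wiredWeight, wiredWeight, h.wiredComponents_eq ha, h.card_mapEdges ha, c]

theorem IsDomainIso.rcMean_eq (h : IsDomainIso G Λ H Λ' f g) {F : Finset G.edgeSet → ℝ}
    {F' : Finset H.edgeSet → ℝ} (hF : ∀ a, a ⊆ edgesIn G Λ → F' (mapEdges H Λ' f a) = F a) :
    rcMean H p q Λ' F' = rcMean G p q Λ F := by
  have key : ∀ (F : Finset G.edgeSet → ℝ) (F' : Finset H.edgeSet → ℝ),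
      (∀ a, a ⊆ edgesIn G Λ → F' (mapEdges H Λ' f a) = F a) →
      ∑ b ∈ (edgesIn H Λ').powerset, F' b = ∑ a ∈ (edgesIn G Λ).powerset, F a := by
    intro F F' hF
    refine (Finset.sum_nbij' (mapEdges H Λ' f) (mapEdges G Λ g) ?_ ?_ ?_ ?_ ?_).symm
    · exact fun a _ => Finset.mem_powerset.2 (mapEdges_subset a)
    · exact fun a _ => Finset.mem_powerset.2 (mapEdges_subset a)
    · exact fun a ha => h.mapEdges_mapEdges (Finset.mem_powerset.1 ha)
    · exact fun a ha => h.symm.mapEdges_mapEdges (Finset.mem_powerset.1 ha)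
    · exact fun a ha => (hF a (Finset.mem_powerset.1 ha)).symm
  rw [rcMean, rcMean, mean, mean]
  congr 1
  · exact key _ _ fun a ha => by rw [h.wiredWeight_eq ha, hF a ha]
  · exact key _ _ fun a ha => h.wiredWeight_eq ha

theorem IsDomainIso.reach_map (h : IsDomainIso G Λ H Λ' f g) {a : Finset G.edgeSet}
    (ha : a ⊆ edgesIn G Λ) {o : V} (ho : o ∈ Λ) {n : ℕ}
    (hd : ∀ x ∈ Λ, G.dist o x ≤ H.dist (f o) (f x))
    (hr : configOf a ∈ reach G o n) : configOf (mapEdges H Λ' f a) ∈ reach H (f o) n := by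
  obtain ⟨x, hx, hr⟩ := hr
  have key : x ∈ Λ ∧ (openGraph (configOf (mapEdges H Λ' f a))).Reachable (f o) (f x) := by
    refine reachable_induction (P := fun x => x ∈ Λ ∧
      (openGraph (configOf (mapEdges H Λ' f a))).Reachable (f o) (f x))
      ⟨ho, SimpleGraph.Reachable.refl _⟩ ?_ hr
    rintro x y - ⟨hx, hr⟩ hxy
    rw [openGraph_configOf_adj] at hxy
    obtain ⟨e, he, hxy⟩ := hxy
    have hy : y ∈ Λ := mem_edgesIn.1 (ha he) y (by rw [hxy]; exact Sym2.mem_mk_right x y)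
    refine ⟨hy, hr.trans (SimpleGraph.Adj.reachable ?_)⟩
    rw [openGraph_configOf_adj, h.exists_mapEdges_iff ha hx hy]
    exact ⟨e, he, hxy⟩
  exact ⟨f x, hx.trans (hd x key.1), key.2⟩

theorem theta_eq_of_domainIso (hG : IsInfiniteTransitive G)
    {o : V} {m : ℕ} (h : IsDomainIso G (ball G o m) H (ball H (f o) m) f g)
    (hd : ∀ x ∈ ball G o m, H.dist (f o) (f x) = G.dist o x) :
    theta H p q (f o) m = theta G p q o m := by
  refine h.rcMean_eq fun a ha => ?_
  have ho := hG.center_mem_ball o m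
  refine le_antisymm (eventFn_le_eventFn fun hr => ?_) (eventFn_le_eventFn fun hr => ?_)
  · have := h.symm.reach_map (mapEdges_subset (f := f) a) (h.maps o ho) (n := m) (fun y hy => ?_) hr
    · rwa [h.mapEdges_mapEdges ha, h.left o ho] at this
    · have := hd (g y) (h.maps' y hy)
      rw [h.right y hy] at this
      rw [this, h.left o ho]
  · exact h.reach_map ha ho (fun x hx => (hd x hx).ge) hr

theorem dist_hom_le (φ : G →g H) (hG : G.Connected) (x y : V) :
    H.dist (φ x) (φ y) ≤ G.dist x y := by
  obtain ⟨w, hw⟩ := hG.exists_walk_length_eq_dist x y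
  rw [← hw, ← SimpleGraph.Walk.length_map φ w]
  exact SimpleGraph.dist_le _

/-- By transitivity, the connection probabilities in balls do not depend on the center. -/
theorem IsInfiniteTransitive.theta_eq (hG : IsInfiniteTransitive G) (o x : V) (m : ℕ) :
    theta G p q x m = theta G p q o m := by
  obtain ⟨φ, rfl⟩ := hG.transitive o x
  have hd : ∀ x y, G.dist (φ x) (φ y) = G.dist x y := fun x y => by
    refine le_antisymm (dist_hom_le φ.toHom hG.connected x y) ?_
    have := dist_hom_le φ.symm.toHom hG.connected (φ x) (φ y)
    simpa using this
  refine theta_eq_of_domainIso (f := φ) (g := φ.symm) hG ⟨?_, ?_, ?_, ?_, ?_, ?_, ?_, ?_⟩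
    fun x _ => hd o x
  · intro x hx
    rwa [hG.mem_ball, hd, ← hG.mem_ball]
  · intro y hy
    rw [hG.mem_ball] at hy ⊢
    rwa [← hd, RelIso.apply_symm_apply]
  · intro x _; simp
  · intro x _; simp
  · intro x _ y _ hxy; exact φ.map_adj_iff.2 hxy
  · intro x _ y _ hxy; exact φ.symm.map_adj_iff.2 hxy
  · rintro x ⟨hx, y, hy, hxy⟩
    rw [hG.mem_ball] at hx hy
    exact ⟨by rwa [hG.mem_ball, hd], φ y, by rwa [hG.mem_ball, hd], φ.map_adj_iff.2 hxy⟩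
  · rintro x ⟨hx, y, hy, hxy⟩
    rw [hG.mem_ball] at hx hy
    refine ⟨?_, φ.symm y, ?_, φ.symm.map_adj_iff.2 hxy⟩
    · rwa [hG.mem_ball, ← hd, RelIso.apply_symm_apply]
    · rwa [hG.mem_ball, ← hd, RelIso.apply_symm_apply]

/-- A geodesic to the centre stays in the ball, so a rooted homomorphism of the induced balls does
not increase the ambient distance to the root, although distances between other vertices may be
realised outside the ball. -/
theorem dist_le_of_induce_hom (hc : G.Connected) (hc' : H.Connected) {o : V} {o' : W} {R : ℕ}
    (φ : G.induce (closedBall G o R) →g H.induce (closedBall H o' R))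
    (hφ : ∀ x : closedBall G o R, (x : V) = o → (φ x : W) = o') :
    ∀ x : closedBall G o R, H.dist o' (φ x) ≤ G.dist o x := by
  have key : ∀ (d : ℕ) (x : closedBall G o R), G.dist o x = d → H.dist o' (φ x) ≤ d := by
    intro d
    induction d with
    | zero =>
      intro x hx
      rw [hφ x (hc.dist_eq_zero_iff.1 hx).symm, SimpleGraph.dist_self]
    | succ d ih =>
      intro x hx
      obtain ⟨y, hxy, hyd⟩ := exists_adj_dist_eq hc hx
      have hxR : G.dist o x ≤ R := x.2
      have hy : y ∈ closedBall G o R := show G.dist o y ≤ R by omega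
      have h3 := ih ⟨y, hy⟩ hyd
      have h4 : (H.induce (closedBall H o' R)).Adj (φ ⟨y, hy⟩) (φ x) :=
        φ.map_adj (show G.Adj y x from hxy.symm)
      exact le_trans (b := H.dist o' (φ ⟨y, hy⟩) + 1)
        (dist_le_succ_of_adj hc' o' (show H.Adj _ _ from h4)) (by omega)
  exact fun x => key _ x rfl

/-- The connection probabilities in balls depend only on the balls of a slightly larger radius. -/
theorem theta_eq_of_ballsIsomorphic (hG : IsInfiniteTransitive G) (hH : IsInfiniteTransitive H)
    {o : V} {o' : W} {m : ℕ} (h : BallsIsomorphic G o H o' (m + 1)) :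
    theta G p q o m = theta H p q o' m := by
  obtain ⟨φ, hφ⟩ := h
  have ho : o ∈ closedBall G o (m + 1) := by
    change G.dist o o ≤ _; rw [SimpleGraph.dist_self]; omega
  have hφ' : ∀ y : closedBall H o' (m + 1), (y : W) = o' → (φ.symm y : V) = o := by
    intro y hy
    have : φ ⟨o, ho⟩ = y := Subtype.ext ((hφ _ rfl).trans hy.symm)
    rw [← this, RelIso.symm_apply_apply]
  have d1 := dist_le_of_induce_hom hG.connected hH.connected φ.toHom hφ
  have d2 := dist_le_of_induce_hom hH.connected hG.connected φ.symm.toHom hφ'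
  have hd : ∀ x : closedBall G o (m + 1), H.dist o' (φ x) = G.dist o x := by
    intro x
    refine le_antisymm (d1 x) ?_
    have := d2 (φ x)
    simpa using this
  have hd' : ∀ y : closedBall H o' (m + 1), G.dist o (φ.symm y) = H.dist o' y := by
    intro y
    rw [← hd, RelIso.apply_symm_apply]
  -- The values outside the balls of radius `m + 1` are arbitrary and never matter.
  let f : V → W := fun x => if h : x ∈ closedBall G o (m + 1) then φ ⟨x, h⟩ else o'
  let g : W → V := fun y => if h : y ∈ closedBall H o' (m + 1) then φ.symm ⟨y, h⟩ else o
  have hf : ∀ x : closedBall G o (m + 1), f x = φ x := fun x => dif_pos x.2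
  have hg : ∀ y : closedBall H o' (m + 1), g y = φ.symm y := fun x => dif_pos x.2
  have hfo : f o = o' := (hf ⟨o, ho⟩).trans (hφ _ rfl)
  have lift : ∀ x ∈ ball G o m, ∃ x' : closedBall G o (m + 1), (x' : V) = x := fun x hx =>
    ⟨⟨x, (hG.mem_ball.1 hx).trans (Nat.le_succ m)⟩, rfl⟩
  have lift' : ∀ x ∈ ball H o' m, ∃ x' : closedBall H o' (m + 1), (x' : W) = x := fun x hx =>
    ⟨⟨x, (hH.mem_ball.1 hx).trans (Nat.le_succ m)⟩, rfl⟩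
  have maps : ∀ x ∈ ball G o m, f x ∈ ball H o' m := by
    intro x hx
    obtain ⟨x, rfl⟩ := lift x hx
    rwa [hH.mem_ball, hf, hd, ← hG.mem_ball]
  have maps' : ∀ y ∈ ball H o' m, g y ∈ ball G o m := by
    intro x hx
    obtain ⟨x, rfl⟩ := lift' x hx
    rwa [hG.mem_ball, hg, hd', ← hH.mem_ball]
  have iso : IsDomainIso G (ball G o m) H (ball H o' m) f g := by
    refine ⟨maps, maps', ?_, ?_, ?_, ?_, ?_, ?_⟩
    · intro x hx
      obtain ⟨x, rfl⟩ := lift x hx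
      rw [hf, hg, RelIso.symm_apply_apply]
    · intro x hx
      obtain ⟨x, rfl⟩ := lift' x hx
      rw [hg, hf, RelIso.apply_symm_apply]
    · intro x hx y hy hxy
      obtain ⟨x, rfl⟩ := lift x hx
      obtain ⟨y, rfl⟩ := lift y hy
      rw [hf, hf]
      exact φ.map_adj_iff.2 hxy
    · intro x hx y hy hxy
      obtain ⟨x, rfl⟩ := lift' x hx
      obtain ⟨y, rfl⟩ := lift' y hy
      rw [hg, hg]
      exact φ.symm.map_adj_iff.2 hxy
    -- The radius `m + 1` is needed here: a boundary vertex of the ball of radius `m` is recognised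
    -- by a neighbour at distance `m + 1`.
    · rintro x ⟨hx, y, hy, hxy⟩
      refine ⟨maps x hx, f y, ?_, ?_⟩
      all_goals
        have hy1 : G.dist o y ≤ m + 1 := (dist_le_succ_of_adj hG.connected o hxy).trans
          (by have := hG.mem_ball.1 hx; omega)
        obtain ⟨x, rfl⟩ := lift x hx
        obtain ⟨y, rfl⟩ : ∃ y' : closedBall G o (m + 1), (y' : V) = y := ⟨⟨y, hy1⟩, rfl⟩
      · rwa [hH.mem_ball, hf, hd, ← hG.mem_ball]
      · rw [hf, hf]
        exact φ.map_adj_iff.2 hxy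
    · rintro x ⟨hx, y, hy, hxy⟩
      refine ⟨maps' x hx, g y, ?_, ?_⟩
      all_goals
        have hy1 : H.dist o' y ≤ m + 1 := (dist_le_succ_of_adj hH.connected o' hxy).trans
          (by have := hH.mem_ball.1 hx; omega)
        obtain ⟨x, rfl⟩ := lift' x hx
        obtain ⟨y, rfl⟩ : ∃ y' : closedBall H o' (m + 1), (y' : W) = y := ⟨⟨y, hy1⟩, rfl⟩
      · rwa [hG.mem_ball, hg, hd', ← hH.mem_ball]
      · rw [hg, hg]
        exact φ.symm.map_adj_iff.2 hxy
  rw [← hfo] at iso ⊢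
  refine (theta_eq_of_domainIso hG iso fun x hx => ?_).symm
  obtain ⟨x, rfl⟩ := lift x hx
  rw [hf, hfo, hd]

end Isomorphisms

/-! ### Dependence on `p`: derivative as a covariance, continuity and monotonicity. -/

section Derivative

open scoped Classical

variable {V : Type u} {G : SimpleGraph V} {p q : ℝ}

theorem wiredWeight_hasDerivAt (hp : p ∈ Set.Ioo (0 : ℝ) 1) {Λ : Finset V}
    {a : Finset G.edgeSet} (ha : a ⊆ edgesIn G Λ) :
    HasDerivAt (fun p => wiredWeight G p q Λ a)
      (wiredWeight G p q Λ a * (a.card - (edgesIn G Λ).card * p) / (p * (1 - p))) p := by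
  have h0 : p ≠ 0 := hp.1.ne'
  have h1 : 1 - p ≠ 0 := (sub_pos.2 hp.2).ne'
  have hc : ((edgesIn G Λ).card : ℝ) = (edgesIn G Λ \ a).card + a.card := by
    exact_mod_cast (Finset.card_sdiff_add_card_eq_card ha).symm
  have pw : ∀ (k : ℕ) (x : ℝ), x ≠ 0 → (k : ℝ) * x ^ (k - 1) = k * x ^ k / x := by
    intro k x hx
    cases k with
    | zero => simp
    | succ k => rw [pow_succ]; field_simp; simp
  have d := (((hasDerivAt_id p).pow a.card).mul
    (((hasDerivAt_id p).const_sub 1).pow (edgesIn G Λ \ a).card)).mul_const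
    (q ^ wiredComponents G Λ a)
  refine d.congr_deriv ?_
  simp only [id, Pi.pow_apply]
  rw [pw _ _ h0, pw _ _ h1, hc, wiredWeight]
  field_simp
  ring

theorem sum_wiredWeight_pos (hp : p ∈ Set.Ico (0 : ℝ) 1) (hq : 1 ≤ q) (Λ : Finset V) :
    0 < ∑ a ∈ (edgesIn G Λ).powerset, wiredWeight G p q Λ a := by
  refine Finset.sum_pos' (fun a _ => wiredWeight_nonneg ⟨hp.1, hp.2.le⟩ hq Λ a)
    ⟨∅, Finset.empty_mem_powerset _, ?_⟩
  rw [wiredWeight, Finset.card_empty, pow_zero, one_mul]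
  exact mul_pos (pow_pos (by linarith [hp.2]) _) (pow_pos (by linarith) _)

/-- The logarithmic derivative of each weight is `(|ω| - |E| * p) / (p * (1 - p))`; the
deterministic part `|E| * p` cancels with the normalisation, leaving a covariance with the number of
open edges. -/
theorem rcMean_hasDerivAt (hp : p ∈ Set.Ioo (0 : ℝ) 1) (hq : 1 ≤ q) (Λ : Finset V)
    (f : Finset G.edgeSet → ℝ) :
    HasDerivAt (fun p => rcMean G p q Λ f)
      (cov (edgesIn G Λ) (wiredWeight G p q Λ) f (fun a => (a.card : ℝ)) / (p * (1 - p))) p := by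
  have hZ := sum_wiredWeight_pos (G := G) ⟨hp.1.le, hp.2⟩ hq Λ
  have hA : ∀ f : Finset G.edgeSet → ℝ,
      HasDerivAt (fun p => ∑ a ∈ (edgesIn G Λ).powerset, wiredWeight G p q Λ a * f a)
      ((∑ a ∈ (edgesIn G Λ).powerset, wiredWeight G p q Λ a * (f a * a.card) -
        (edgesIn G Λ).card * p * ∑ a ∈ (edgesIn G Λ).powerset, wiredWeight G p q Λ a * f a) /
          (p * (1 - p))) p := by
    intro f
    have := HasDerivAt.fun_sum (u := (edgesIn G Λ).powerset) fun a ha =>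
      (wiredWeight_hasDerivAt (q := q) hp (Finset.mem_powerset.1 ha)).mul_const (f a)
    refine this.congr_deriv ?_
    rw [Finset.mul_sum, ← Finset.sum_sub_distrib, Finset.sum_div]
    refine Finset.sum_congr rfl fun a _ => ?_
    ring
  have h1 := hA (fun _ => 1)
  simp only [mul_one, one_mul] at h1
  have h0 : p ≠ 0 := hp.1.ne'
  have h1p : 1 - p ≠ 0 := (sub_pos.2 hp.2).ne'
  refine ((hA f).div h1 hZ.ne').congr_deriv ?_
  rw [cov, mean, mean, mean]
  have hZ' := hZ.ne'
  field_simp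
  ring

theorem rcMean_continuousOn (hq : 1 ≤ q) (Λ : Finset V) (f : Finset G.edgeSet → ℝ) :
    ContinuousOn (fun p => rcMean G p q Λ f) (Set.Ico 0 1) := by
  have hw : ∀ a, Continuous fun p => wiredWeight G p q Λ a := fun a => by
    unfold wiredWeight; fun_prop
  refine ContinuousOn.div ?_ ?_ fun p hp => (sum_wiredWeight_pos hp hq Λ).ne'
  · exact (continuous_finsetSum _ fun a _ => (hw a).mul continuous_const).continuousOn
  · exact (continuous_finsetSum _ fun a _ => hw a).continuousOn

theorem card_eq_sum_openAt {ι : Type*} [DecidableEq ι] {E a : Finset ι} (ha : a ⊆ E) :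
    (a.card : ℝ) = ∑ e ∈ E, openAt e a := by
  simp only [openAt, Finset.sum_ite_mem, Finset.inter_eq_right.2 ha, Finset.sum_const, nsmul_eq_mul,
    mul_one]

theorem cov_card_eq {ι : Type*} [DecidableEq ι] (E : Finset ι) (w f : Finset ι → ℝ) :
    cov E w f (fun a => (a.card : ℝ)) = ∑ e ∈ E, cov E w f (openAt e) := by
  simp only [cov, Finset.sum_sub_distrib, ← Finset.mul_sum, ← mean_sum]
  congr 1
  · exact mean_congr fun a ha _ => by rw [card_eq_sum_openAt ha]
  · rw [mean_congr fun a ha _ => card_eq_sum_openAt ha]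

theorem cov_card_nonneg (hp : p ∈ Set.Ioo (0 : ℝ) 1) (hq : 1 ≤ q) {Λ : Finset V}
    (hb : (vertexBoundary G Λ).Nonempty) {f : Finset G.edgeSet → ℝ} (hf : ∀ a, 0 ≤ f a)
    (hmono : ∀ a b, a ⊆ b → f a ≤ f b) :
    0 ≤ cov (edgesIn G Λ) (wiredWeight G p q Λ) f (fun a => (a.card : ℝ)) := by
  rw [cov_card_eq]
  exact Finset.sum_nonneg fun e _ => (isLatticeWeight hp hq hb).cov_nonneg hf (openAt_nonneg e)
    (fun a b h _ => hmono a b h) (openAt_increasing e)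

/-- On the open interval the derivative is nonnegative by FKG; continuity adds the endpoint `p = 0`,
used when comparing with percolation at a parameter that may vanish. -/
theorem rcMean_monotoneOn (hq : 1 ≤ q) {Λ : Finset V} (hb : (vertexBoundary G Λ).Nonempty)
    {f : Finset G.edgeSet → ℝ} (hf : ∀ a, 0 ≤ f a) (hmono : ∀ a b, a ⊆ b → f a ≤ f b) :
    MonotoneOn (fun p => rcMean G p q Λ f) (Set.Ico 0 1) := by
  refine monotoneOn_of_deriv_nonneg (convex_Ico 0 1) (rcMean_continuousOn hq Λ f) ?_ ?_
  · rw [interior_Ico]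
    exact fun p hp => (rcMean_hasDerivAt hp hq Λ f).differentiableAt.differentiableWithinAt
  · rw [interior_Ico]
    intro p hp
    rw [(rcMean_hasDerivAt hp hq Λ f).deriv]
    exact div_nonneg (cov_card_nonneg hp hq hb hf hmono)
      (mul_nonneg hp.1.le (sub_nonneg.2 hp.2.le))

end Derivative

/-! ### Differential inequality from OSSS and the finite-volume criterion. -/

section Sharpness

open scoped Classical

variable {V : Type u} {G : SimpleGraph V} {p q : ℝ}

/-- The event that `x` is connected by an open path to the sphere of radius `k` around `o`. -/
def sphereReach (G : SimpleGraph V) (o : V) (k : ℕ) (x : V) : Set (Config G) :=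
  {ω | ∃ z, G.dist o z = k ∧ (openGraph ω).Reachable z x}

theorem openGraph_configOf_mono {a b : Finset G.edgeSet} (h : a ⊆ b) :
    openGraph (configOf a) ≤ openGraph (configOf b) :=
  openGraph_mono fun _ he => configOf_eq_true.2 (h (configOf_eq_true.1 he))

theorem theta_nonneg (hp : p ∈ Set.Icc (0 : ℝ) 1) (hq : 1 ≤ q) (o : V) (m : ℕ) :
    0 ≤ theta G p q o m :=
  mean_nonneg (wiredWeight_nonneg hp hq _) (eventFn_nonneg _)

/-- When `k` and the distance from `o` to `x` differ by at least `m`, the triangle inequality turns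
a connection to the sphere into a connection of `x` to distance `m`. The ball of radius `m` around
`x` fits in the domain of radius `n + m`, and transitivity moves its centre to `o`. Otherwise the
trivial bound 1 is used. -/
theorem IsInfiniteTransitive.rcMean_sphereReach_le (hG : IsInfiniteTransitive G)
    (hp : p ∈ Set.Ioo (0 : ℝ) 1) (hq : 1 ≤ q) (o x : V) {m n : ℕ} (hx : G.dist o x ≤ n) (k : ℕ) :
    rcMean G p q (ball G o (n + m)) (eventFn (sphereReach G o k x)) ≤
      if k < G.dist o x + m ∧ G.dist o x < k + m then 1 else theta G p q o m := by
  have hp' : p ∈ Set.Icc (0 : ℝ) 1 := ⟨hp.1.le, hp.2.le⟩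
  split_ifs with h
  · refine (rcMean_le_rcMean hp' hq fun a => eventFn_le_one _ a).trans_eq ?_
    exact mean_const (sum_wiredWeight_pos ⟨hp.1.le, hp.2⟩ hq _) 1
  · rw [← hG.theta_eq o x m]
    refine le_trans (rcMean_le_rcMean hp' hq fun a => eventFn_le_eventFn ?_)
      (hG.rcMean_reach_le_theta hp hq (hG.ball_subset_ball (by omega)))
    rintro ⟨z, hz, hr⟩
    refine ⟨z, ?_, hr.symm⟩
    have h1 := hG.connected.dist_triangle (u := o) (v := x) (w := z)
    have h2 := hG.connected.dist_triangle (u := o) (v := z) (w := x)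
    rw [SimpleGraph.dist_comm (u := z)] at h2
    omega

/-- At most `2 * m` radii `k` are within distance less than `m` of `d`. -/
theorem sum_ite_near_le (d m n : ℕ) {t : ℝ} (ht : 0 ≤ t) :
    ∑ k ∈ Finset.Icc 1 n, (if k < d + m ∧ d < k + m then (1 : ℝ) else t) ≤ 2 * m + n * t := by
  have h1 : ∀ k ∈ Finset.Icc 1 n, (if k < d + m ∧ d < k + m then (1 : ℝ) else t) ≤
      (if k < d + m ∧ d < k + m then (1 : ℝ) else 0) + t := by
    intro k _
    split_ifs <;> linarith
  refine (Finset.sum_le_sum h1).trans ?_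
  rw [Finset.sum_add_distrib, Finset.sum_const, Nat.card_Icc, Nat.add_sub_cancel, nsmul_eq_mul,
    ← Finset.sum_filter, Finset.sum_const, nsmul_eq_mul, mul_one]
  refine add_le_add_left ?_ _
  have h2 : ((Finset.Icc 1 n).filter fun k => k < d + m ∧ d < k + m) ⊆
      Finset.Ico (d - m) (d + m) := by
    intro k hk
    rw [Finset.mem_filter] at hk
    rw [Finset.mem_Ico]
    omega
  have h3 := Finset.card_le_card h2
  rw [Nat.card_Ico] at h3
  have h4 : ((Finset.Icc 1 n).filter fun k => k < d + m ∧ d < k + m).card ≤ 2 * m := by omega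
  exact_mod_cast h4

/-- An edge of which an endpoint is connected to the sphere of radius `k` around `o`. -/
def touchesSphere (G : SimpleGraph V) (o : V) (k : ℕ) (a : Finset G.edgeSet) (e : G.edgeSet) :
    Prop :=
  ∃ x ∈ (e : Sym2 V), configOf a ∈ sphereReach G o k x

theorem touchesSphere_mono {o : V} {k : ℕ} (a b : Finset G.edgeSet) (e : G.edgeSet) (h : a ⊆ b) :
    touchesSphere G o k a e → touchesSphere G o k b e := by
  rintro ⟨x, hx, z, hz, hr⟩
  exact ⟨x, hx, z, hz, hr.mono (openGraph_configOf_mono h)⟩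

/-- The exploration of the clusters of a sphere determines whether its center is connected to
distance `n`. -/
theorem IsInfiniteTransitive.eventFn_reach_of_explored (hG : IsInfiniteTransitive G) {o : V}
    {k n : ℕ} (hk : k ≤ n) {a F : Finset G.edgeSet}
    (h : ∀ e ∈ edgesIn G (ball G o n), e ∉ F → ¬ touchesSphere G o k (a ∩ F) e) :
    eventFn (reach G o n) (a ∩ F) = eventFn (reach G o n) a := by
  refine le_antisymm (eventFn_reach_mono o n _ _ Finset.inter_subset_left) ?_
  rw [← hG.eventFn_reach_inter]
  refine eventFn_le_eventFn ?_
  rintro ⟨x, hx, hr⟩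
  set H := openGraph (configOf (a ∩ edgesIn G (ball G o n)))
  -- The cluster of `o` must cross the sphere of radius `k` at some `z`. From `z`, each open edge
  -- met in the ball touches a cluster of the sphere already revealed, so it belongs to `F`; the
  -- whole connection is therefore seen in `a ∩ F`.
  obtain ⟨z, hz, hoz⟩ := exists_reachable_dist_eq hG.connected (openGraph_le _) hr (hk.trans hx)
  have key : ∀ y, H.Reachable z y → (openGraph (configOf (a ∩ F))).Reachable z y := by
    intro y hy
    refine reachable_induction (P := fun y => (openGraph (configOf (a ∩ F))).Reachable z y)
      (SimpleGraph.Reachable.refl _) ?_ hy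
    intro y y' _ ih hyy
    obtain ⟨e, he, hee⟩ := openGraph_configOf_adj.1 hyy
    rw [Finset.mem_inter] at he
    refine ih.trans (SimpleGraph.Adj.reachable (openGraph_configOf_adj.2 ⟨e, ?_, hee⟩))
    rw [Finset.mem_inter]
    refine ⟨he.1, by_contra fun heF => h e he.2 heF ⟨y, ?_, z, hz, ih⟩⟩
    rw [hee]; exact Sym2.mem_mk_left y y'
  exact ⟨x, hx, (key o hoz.symm).symm.trans (key x (hoz.symm.trans hr))⟩

/-- The OSSS inequality for the connection event, averaged over the explorations of the clusters
of the spheres. -/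
theorem IsInfiniteTransitive.variance_reach_le (hG : IsInfiniteTransitive G)
    (hp : p ∈ Set.Ioo (0 : ℝ) 1) (hq : 1 ≤ q) (o : V) (m n : ℕ) :
    n * (rcMean G p q (ball G o (n + m)) (eventFn (reach G o n)) *
        (1 - rcMean G p q (ball G o (n + m)) (eventFn (reach G o n)))) ≤
      2 * (2 * m + n * theta G p q o m) * cov (edgesIn G (ball G o (n + m)))
        (wiredWeight G p q (ball G o (n + m))) (eventFn (reach G o n))
        (fun a => (a.card : ℝ)) := by
  set Λ := ball G o (n + m) with hΛ
  set f := eventFn (reach G o n) with hf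
  set w := wiredWeight G p q Λ with hwdef
  have hp' : p ∈ Set.Icc (0 : ℝ) 1 := ⟨hp.1.le, hp.2.le⟩
  have hw : IsLatticeWeight (edgesIn G Λ) w := isLatticeWeight hp hq (hG.boundary_ball _ _)
  have hsub : ball G o n ⊆ Λ := hG.ball_subset_ball (by rw [SimpleGraph.dist_self]; omega)
  have hE := edgesIn_mono (G := G) hsub
  have hfm : IncreasingOn (edgesIn G Λ) f := fun a b h _ => eventFn_reach_mono o n a b h
  have hc : ∀ e, 0 ≤ cov (edgesIn G Λ) w f (openAt e) := fun e =>
    hw.cov_nonneg (eventFn_nonneg _) (openAt_nonneg e) hfm (openAt_increasing e)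
  have var : cov (edgesIn G Λ) w f f = rcMean G p q Λ f * (1 - rcMean G p q Λ f) := by
    have : (fun a => f a * f a) = f := by
      ext a; simp only [hf, eventFn]; split_ifs <;> norm_num
    rw [cov, this, rcMean]; ring
  have hθ := theta_nonneg (G := G) hp' hq o m
  have step : ∀ k ∈ Finset.Icc 1 n, cov (edgesIn G Λ) w f f ≤
      ∑ e ∈ edgesIn G (ball G o n), mean (edgesIn G Λ) w
        (fun a => if touchesSphere G o k a e then 1 else 0) * cov (edgesIn G Λ) w f (openAt e) :=
    fun k hk => variance_le_of_exploration hw hE (touchesSphere G o k) touchesSphere_mono f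
      (fun a => ⟨eventFn_nonneg _ a, eventFn_le_one _ a⟩) hfm
      fun a F _ _ h => hG.eventFn_reach_of_explored (Finset.mem_Icc.1 hk).2 h
  -- Each sphere gives a bound on the same variance. Summing over the `n` radii and exchanging the
  -- sums leaves, for each edge, its total revealment.
  have sum := Finset.sum_le_sum step
  rw [Finset.sum_const, Nat.card_Icc, Nat.add_sub_cancel, nsmul_eq_mul, Finset.sum_comm] at sum
  rw [← var]
  refine sum.trans ?_
  rw [cov_card_eq, Finset.mul_sum]
  refine le_trans (Finset.sum_le_sum fun e he => ?_)
    (Finset.sum_le_sum_of_subset_of_nonneg hE fun e _ _ => mul_nonneg (by positivity) (hc e))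
  rw [← Finset.sum_mul]
  refine mul_le_mul_of_nonneg_right ?_ (hc e)
  obtain ⟨e, hadj⟩ := e
  induction e with
  | h x y =>
    rw [mem_edgesIn] at he
    have hx : G.dist o x ≤ n := hG.mem_ball.1 (he x (Sym2.mem_mk_left x y))
    have hy : G.dist o y ≤ n := hG.mem_ball.1 (he y (Sym2.mem_mk_right x y))
    -- A union bound over the two endpoints of the edge, which is the source of the overall factor
    -- 2.
    have bound : ∀ k ∈ Finset.Icc 1 n, mean (edgesIn G Λ) w
        (fun a => if touchesSphere G o k a ⟨s(x, y), hadj⟩ then 1 else 0) ≤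
        (if k < G.dist o x + m ∧ G.dist o x < k + m then 1 else theta G p q o m) +
        (if k < G.dist o y + m ∧ G.dist o y < k + m then 1 else theta G p q o m) := by
      intro k _
      refine le_trans ?_ (add_le_add (hG.rcMean_sphereReach_le hp hq o x hx k)
        (hG.rcMean_sphereReach_le hp hq o y hy k))
      rw [rcMean, rcMean, ← mean_add]
      refine mean_le_mean hw.nonneg fun a _ _ => ?_
      have n1 := eventFn_nonneg (sphereReach G o k x) a
      have n2 := eventFn_nonneg (sphereReach G o k y) a
      split_ifs with h
      · obtain ⟨z, hz, hr⟩ := h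
        rcases Sym2.mem_iff.1 hz with rfl | rfl
        · have : eventFn (sphereReach G o k z) a = 1 := if_pos hr
          linarith
        · have : eventFn (sphereReach G o k z) a = 1 := if_pos hr
          linarith
      · linarith
    refine (Finset.sum_le_sum bound).trans ?_
    rw [Finset.sum_add_distrib]
    linarith [sum_ite_near_le (G.dist o x) m n hθ, sum_ite_near_le (G.dist o y) m n hθ]

/-- Grönwall's inequality, in the form used below. -/
theorem le_mul_exp_of_deriv_ge {g g' : ℝ → ℝ} {s p t : ℝ} (hs : s ≤ p) (ht : 0 < t)
    (hg : ∀ x ∈ Set.Icc s p, HasDerivAt g (g' x) x) (h : ∀ x ∈ Set.Icc s p, g x ≤ t * g' x) :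
    g s ≤ g p * Real.exp (-((p - s) / t)) := by
  have hd : ∀ x ∈ Set.Icc s p, HasDerivAt (fun x => g x * Real.exp (-(x / t)))
      (g' x * Real.exp (-(x / t)) + g x * (Real.exp (-(x / t)) * -(1 / t))) x := fun x hx =>
    (hg x hx).mul (((hasDerivAt_id x).div_const t).neg.exp)
  have hm : MonotoneOn (fun x => g x * Real.exp (-(x / t))) (Set.Icc s p) := by
    refine monotoneOn_of_deriv_nonneg (convex_Icc s p)
      (fun x hx => (hd x hx).continuousAt.continuousWithinAt)
      (fun x hx => (hd x (interior_subset hx)).differentiableAt.differentiableWithinAt)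
      fun x hx => ?_
    rw [(hd x (interior_subset hx)).deriv]
    have h1 : g x / t ≤ g' x := by
      rw [div_le_iff₀ ht, mul_comm]; exact h x (interior_subset hx)
    have h2 : 0 ≤ (g' x - g x / t) * Real.exp (-(x / t)) :=
      mul_nonneg (sub_nonneg.2 h1) (Real.exp_pos _).le
    calc (0 : ℝ) ≤ (g' x - g x / t) * Real.exp (-(x / t)) := h2
      _ = _ := by ring
  have := hm (Set.left_mem_Icc.2 hs) (Set.right_mem_Icc.2 hs) hs
  calc g s = g s * Real.exp (-(s / t)) * Real.exp (s / t) := by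
        rw [mul_assoc, ← Real.exp_add, neg_add_cancel, Real.exp_zero, mul_one]
    _ ≤ g p * Real.exp (-(p / t)) * Real.exp (s / t) :=
        mul_le_mul_of_nonneg_right this (Real.exp_pos _).le
    _ = _ := by rw [mul_assoc, ← Real.exp_add]; congr 2; ring

theorem IsInfiniteTransitive.theta_monotoneOn (hG : IsInfiniteTransitive G) (hq : 1 ≤ q) (o : V)
    (m : ℕ) : MonotoneOn (fun p => theta G p q o m) (Set.Ico 0 1) :=
  rcMean_monotoneOn hq (hG.boundary_ball o m) (eventFn_nonneg _) (eventFn_reach_mono o m)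

/-- If the connection probability is below `t` at `p`, then it is eventually below `t / 2`
at `p - t`. -/
theorem IsInfiniteTransitive.exists_theta_lt_half (hG : IsInfiniteTransitive G) (hq : 1 ≤ q)
    (o : V) (hp : p < 1) {t : ℝ} (ht : 0 < t) (ht' : t ≤ 1 / 2) (htp : t < p) {m : ℕ}
    (hm : theta G p q o m < t) : ∃ M, theta G (p - t) q o M < t / 2 := by
  obtain ⟨n₀, hn₀⟩ := exists_nat_ge (2 * m / (t - theta G p q o m))
  set n := n₀ + m + 1 with hn
  -- The gap `t - theta G p q o m` absorbs the contribution `2 * m` of the nearby spheres once `n`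
  -- is large.
  have hnt : 2 * m + n * theta G p q o m ≤ n * t := by
    rw [div_le_iff₀ (sub_pos.2 hm)] at hn₀
    have : (n : ℝ) = n₀ + (m + 1) := by rw [hn]; push_cast; ring
    have h2 : 0 ≤ ((m : ℝ) + 1) * (t - theta G p q o m) :=
      mul_nonneg (by positivity) (sub_nonneg.2 hm.le)
    rw [this]
    nlinarith
  have hnpos : (0 : ℝ) < n := by rw [hn]; positivity
  have hp0 : p ∈ Set.Ioo (0 : ℝ) 1 := ⟨ht.trans htp, hp⟩
  refine ⟨n + m, ?_⟩
  set Λ := ball G o (n + m) with hΛ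
  set f := eventFn (reach G o n) with hf
  -- Monotonicity in the parameter and in the domain keep both connection probabilities below their
  -- common bound at `p` on the whole interval.
  have small : ∀ s ∈ Set.Icc (p - t) p, rcMean G s q Λ f ≤ theta G p q o m ∧
      theta G s q o m ≤ theta G p q o m := by
    intro s hs
    have hs0 : s ∈ Set.Ioo (0 : ℝ) 1 := ⟨by linarith [hs.1], by linarith [hs.2]⟩
    have h1 : theta G s q o m ≤ theta G p q o m :=
      hG.theta_monotoneOn hq o m ⟨hs0.1.le, hs0.2⟩ ⟨hp0.1.le, hp⟩ hs.2
    refine ⟨le_trans (le_trans ?_ (hG.rcMean_reach_le_theta hs0 hq (hG.ball_subset_ball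
      (o := o) (x := o) (m := m) (n := n + m) ?_))) h1, h1⟩
    · exact rcMean_le_rcMean ⟨hs0.1.le, hs0.2.le⟩ hq fun a =>
        eventFn_le_eventFn fun h => reach_anti (by omega) h
    · rw [SimpleGraph.dist_self]; omega
  have gron := le_mul_exp_of_deriv_ge (g := fun s => rcMean G s q Λ f) (s := p - t) (p := p)
    (by linarith) ht (fun s hs => rcMean_hasDerivAt ⟨by linarith [hs.1], by linarith [hs.2]⟩ hq Λ f)
    fun s hs => by
      have hs0 : s ∈ Set.Ioo (0 : ℝ) 1 := ⟨by linarith [hs.1], by linarith [hs.2]⟩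
      have hs' : s ∈ Set.Icc (0 : ℝ) 1 := ⟨hs0.1.le, hs0.2.le⟩
      obtain ⟨b1, b2⟩ := small s hs
      have hv := hG.variance_reach_le hs0 hq o m n
      have hc := cov_card_nonneg hs0 hq (hG.boundary_ball o (n + m)) (f := f) (eventFn_nonneg _)
        (eventFn_reach_mono o n)
      have hg0 : 0 ≤ rcMean G s q Λ f :=
        mean_nonneg (wiredWeight_nonneg hs' hq Λ) (eventFn_nonneg _)
      rw [← hΛ] at hc hv
      rw [← hf] at hv
      set g := rcMean G s q Λ f
      set C := cov (edgesIn G Λ) (wiredWeight G s q Λ) f (fun a => (a.card : ℝ))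
      have h1 : 2 * (2 * m + n * theta G s q o m) * C ≤ n * (2 * t * C) := by
        have : 2 * m + n * theta G s q o m ≤ n * t :=
          le_trans (add_le_add le_rfl (mul_le_mul_of_nonneg_left b2 hnpos.le)) hnt
        nlinarith
      have h2 : g * (1 - g) ≤ 2 * t * C := le_of_mul_le_mul_left (hv.trans h1) hnpos
      -- Since `g ≤ 1 / 2`, the variance `g * (1 - g)` is at least `g / 2`.
      have h3 : g ≤ 4 * t * C := by nlinarith
      refine h3.trans ?_
      have hss : 0 < s * (1 - s) := mul_pos hs0.1 (sub_pos.2 hs0.2)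
      -- Here `s * (1 - s) ≤ 1 / 4`; the constant 4 exactly matches the one just obtained, giving `g
      -- ≤ t * g'`.
      have h4 : 4 * C ≤ C / (s * (1 - s)) := by
        rw [le_div_iff₀ hss]
        nlinarith [sq_nonneg (1 - 2 * s), mul_nonneg hc (sq_nonneg (1 - 2 * s))]
      calc 4 * t * C = t * (4 * C) := by ring
        _ ≤ _ := mul_le_mul_of_nonneg_left h4 ht.le
  have hs0 : p - t ∈ Set.Ioo (0 : ℝ) 1 := ⟨by linarith, by linarith⟩
  have e1 : theta G (p - t) q o (n + m) ≤ rcMean G (p - t) q Λ f :=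
    rcMean_le_rcMean ⟨hs0.1.le, hs0.2.le⟩ hq fun a =>
      eventFn_le_eventFn fun h => reach_anti (by omega) h
  refine (e1.trans gron).trans_lt ?_
  have e2 : Real.exp (-((p - (p - t)) / t)) < 1 / 2 := by
    rw [sub_sub_cancel, div_self ht.ne', Real.exp_neg, ← one_div]
    exact one_div_lt_one_div_of_lt two_pos (by linarith [Real.exp_one_gt_d9])
  have e3 : rcMean G p q Λ f < t := (small p ⟨by linarith, le_rfl⟩).1.trans_lt hm
  have e4 : 0 ≤ rcMean G p q Λ f :=
    mean_nonneg (wiredWeight_nonneg ⟨hp0.1.le, hp0.2.le⟩ hq Λ) (eventFn_nonneg _)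
  calc rcMean G p q Λ f * Real.exp (-((p - (p - t)) / t)) ≤ rcMean G p q Λ f * (1 / 2) :=
        mul_le_mul_of_nonneg_left e2.le e4
    _ < t / 2 := by linarith

/-- A finite-volume criterion for the absence of percolation: a small connection probability in a
ball at `p` makes the connection probabilities tend to zero slightly below `p`. -/
theorem IsInfiniteTransitive.exists_theta_lt (hG : IsInfiniteTransitive G) (hq : 1 ≤ q)
    (o : V) (hp : p < 1) {t : ℝ} (ht : 0 < t) (ht' : t ≤ 1 / 2) (htp : 2 * t < p) {m : ℕ}
    (hm : theta G p q o m < t) {s : ℝ} (hs : s ∈ Set.Icc 0 (p - 2 * t)) {ε : ℝ} (hε : 0 < ε) :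
    ∃ M, theta G s q o M < ε := by
  -- The `i`-th step has length `t / 2 ^ i` and halves the bound; the lengths still to come add up
  -- to `2 * (t / 2 ^ i)`, so the parameter stays above `p - 2 * t`.
  have key : ∀ i : ℕ, ∃ M, theta G (p - 2 * t + 2 * (t / 2 ^ i)) q o M < t / 2 ^ i := by
    intro i
    induction i with
    | zero => exact ⟨m, by simpa using hm⟩
    | succ i ih =>
      obtain ⟨M, hM⟩ := ih
      have h1 : 0 < t / 2 ^ i := by positivity
      have h2 : t / 2 ^ i ≤ t := div_le_self ht.le (one_le_pow₀ one_le_two)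
      have h3 : t / 2 ^ (i + 1) = t / 2 ^ i / 2 := by rw [pow_succ, div_div]
      obtain ⟨M', hM'⟩ := hG.exists_theta_lt_half hq o (by linarith) h1 (h2.trans ht')
        (by linarith) hM
      refine ⟨M', ?_⟩
      rw [h3]
      convert hM' using 2
      ring
  obtain ⟨i, hi⟩ := exists_pow_lt_of_lt_one (div_pos hε ht) (one_half_lt_one : (1 / 2 : ℝ) < 1)
  obtain ⟨M, hM⟩ := key i
  have h1 : 0 < t / 2 ^ i := by positivity
  have h2 : t / 2 ^ i ≤ t := div_le_self ht.le (one_le_pow₀ one_le_two)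
  refine ⟨M, lt_of_le_of_lt (hG.theta_monotoneOn hq o M ⟨hs.1, by linarith [hs.2]⟩
    ⟨by linarith [hs.1, hs.2], by linarith⟩ (by linarith [hs.2])) (hM.trans ?_)⟩
  rw [lt_div_iff₀ ht, one_div, inv_pow] at hi
  calc t / 2 ^ i = (2 ^ i)⁻¹ * t := by ring
    _ < ε := hi

end Sharpness

/-! ### Finite-volume measures and local events. -/

section FiniteVolume

open scoped Classical

variable {V : Type u} {G : SimpleGraph V} {p q : ℝ}

theorem IsInfiniteTransitive.countable (hG : IsInfiniteTransitive G) : Countable V := by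
  obtain ⟨o⟩ := hG.connected.nonempty
  have h : (Set.univ : Set V) = ⋃ n, closedBall G o n := by
    ext x
    simp only [Set.mem_univ, Set.mem_iUnion, true_iff]
    exact ⟨G.dist o x, le_refl (G.dist o x)⟩
  rw [← Set.countable_univ_iff, h]
  exact Set.countable_iUnion fun n =>
    (finite_closedBall hG.connected hG.locallyFinite o n).countable

/-- The measure is a finite combination of Dirac masses. Countability of `V` makes the singletons of
`Config G` measurable, so no measurability of `f` is required. -/
theorem integral_finiteVolumeMeasure [Countable V] (hp : p ∈ Set.Icc (0 : ℝ) 1) (hq : 1 ≤ q)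
    (Λ : Finset V) (f : Config G → ℝ) :
    ∫ ω, f ω ∂(finiteVolumeMeasure G p q Λ) = rcMean G p q Λ fun a => f (configOf a) := by
  rw [finiteVolumeMeasure, integral_finsetSum_measure]
  · rw [rcMean, mean, Finset.sum_div]
    refine Finset.sum_congr rfl fun a _ => ?_
    rw [integral_smul_measure, integral_dirac, ENNReal.toReal_ofReal, smul_eq_mul,
      mul_div_right_comm]
    · rfl
    · exact div_nonneg (wiredWeight_nonneg hp hq Λ a)
        (Finset.sum_nonneg fun b _ => wiredWeight_nonneg hp hq Λ b)
  · intro a _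
    exact (integrable_dirac (by simp)).smul_measure ENNReal.ofReal_ne_top

theorem isProbabilityMeasure_finiteVolumeMeasure (hp : p ∈ Set.Ico (0 : ℝ) 1) (hq : 1 ≤ q)
    (Λ : Finset V) : IsProbabilityMeasure (finiteVolumeMeasure G p q Λ) := by
  constructor
  have hZ := sum_wiredWeight_pos (G := G) hp hq Λ
  rw [finiteVolumeMeasure, Measure.finsetSum_apply]
  simp only [Measure.smul_apply, measure_univ, smul_eq_mul, mul_one]
  change 0 < wiredPartition G p q Λ at hZ
  rw [← ENNReal.ofReal_sum_of_nonneg fun a _ =>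
    div_nonneg (wiredWeight_nonneg ⟨hp.1, hp.2.le⟩ hq Λ a) hZ.le, ← Finset.sum_div]
  change ENNReal.ofReal (wiredPartition G p q Λ / wiredPartition G p q Λ) = 1
  rw [div_self hZ.ne', ENNReal.ofReal_one]

/-- An event that depends on finitely many edges is open and closed. -/
theorem isClopen_of_finite_support {A : Set (Config G)} (S : Finset G.edgeSet)
    (h : ∀ ω ω' : Config G, (∀ e ∈ S, ω e = ω' e) → ω ∈ A → ω' ∈ A) : IsClopen A := by
  have e : A = (fun (ω : Config G) (e : S) => ω e) ⁻¹'
      ((fun (ω : Config G) (e : S) => ω e) '' A) := by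
    refine Set.Subset.antisymm (Set.subset_preimage_image _ _) ?_
    rintro ω' ⟨ω, hω, hωω'⟩
    exact h ω ω' (fun e he => congrFun hωω' ⟨e, he⟩) hω
  rw [e]
  exact (isClopen_discrete _).preimage (continuous_pi fun e => continuous_apply _)

theorem IsInfiniteTransitive.isClopen_reach (hG : IsInfiniteTransitive G) (o : V) (n : ℕ) :
    IsClopen (reach G o n) :=
  isClopen_of_finite_support (edgesIn G (ball G o n)) fun ω ω' h hω =>
    hG.reach_of_agree (fun e he he' => by rw [← h e he, he']) hω

theorem indicator_configOf (A : Set (Config G)) (a : Finset G.edgeSet) :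
    A.indicator (1 : Config G → ℝ) (configOf a) = eventFn A a := by
  by_cases h : configOf a ∈ A <;> simp [eventFn, h]

/-- Convergence of the probabilities of the local events under a weak limit. -/
theorem tendsto_rcMean_of_isClopen [Countable V] (hp : p ∈ Set.Icc (0 : ℝ) 1) (hq : 1 ≤ q)
    {μ : Measure (Config G)} {l : Filter (Finset V)}
    (hμ : ∀ f : Config G →ᵇ ℝ, Tendsto (fun Λ : Finset V => ∫ ω, f ω ∂(finiteVolumeMeasure G p q Λ))
      l (𝓝 (∫ ω, f ω ∂μ))) {A : Set (Config G)} (hA : IsClopen A) :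
    Tendsto (fun Λ => rcMean G p q Λ (eventFn A)) l (𝓝 (μ.real A)) := by
  have := hμ (BoundedContinuousFunction.indicator A hA)
  change Tendsto (fun Λ => ∫ ω, A.indicator (1 : Config G → ℝ) ω ∂(finiteVolumeMeasure G p q Λ)) l
    (𝓝 (∫ ω, A.indicator (1 : Config G → ℝ) ω ∂μ)) at this
  rw [integral_indicator_one hA.isOpen.measurableSet] at this
  refine this.congr fun Λ => ?_
  rw [integral_finiteVolumeMeasure hp hq]
  simp only [indicator_configOf]

end FiniteVolume

/-! ### Existence of the infinite-volume measure, and percolation under it. -/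

section Existence

open scoped Classical

variable {V : Type u} {G : SimpleGraph V} {p q : ℝ}

/-- The event that all the edges of `F` are open. -/
def allOpen (F : Finset G.edgeSet) : Set (Config G) := {ω | ∀ e ∈ F, ω e = true}

theorem isClopen_allOpen (F : Finset G.edgeSet) : IsClopen (allOpen F) :=
  isClopen_of_finite_support F fun ω ω' h hω e he => by rw [← h e he, hω e he]

theorem generateFrom_allOpen :
    (inferInstance : MeasurableSpace (Config G)) =
      MeasurableSpace.generateFrom (Set.range (allOpen (G := G))) := by
  refine le_antisymm ?_ (MeasurableSpace.generateFrom_le ?_)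
  · refine iSup_le fun e => ?_
    rw [← measurable_iff_comap_le]
    refine @measurable_to_bool _ (MeasurableSpace.generateFrom (Set.range (allOpen (G := G)))) _ ?_
    refine MeasurableSpace.measurableSet_generateFrom ⟨{e}, ?_⟩
    ext ω
    simp [allOpen]
  · rintro _ ⟨F, rfl⟩
    have : allOpen F = ⋂ e ∈ F, (fun ω : Config G => ω e) ⁻¹' {true} := by
      ext ω; simp [allOpen]
    rw [this]
    exact Finset.measurableSet_biInter _ fun e _ => measurable_pi_apply e (measurableSet_singleton _)

theorem isPiSystem_allOpen : IsPiSystem (Set.range (allOpen (G := G))) := by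
  rintro _ ⟨F, rfl⟩ _ ⟨F', rfl⟩ _
  refine ⟨F ∪ F', ?_⟩
  ext ω
  simp only [allOpen, Set.mem_ofPred_eq, Set.mem_inter_iff, Finset.mem_union]
  exact ⟨fun h => ⟨fun e he => h e (Or.inl he), fun e he => h e (Or.inr he)⟩,
    fun h e he => he.elim (h.1 e) (h.2 e)⟩

theorem measure_ext_allOpen {μ ν : Measure (Config G)} [IsProbabilityMeasure μ]
    [IsProbabilityMeasure ν] (h : ∀ F, μ.real (allOpen F) = ν.real (allOpen F)) : μ = ν := by
  refine ext_of_generate_finite _ generateFrom_allOpen isPiSystem_allOpen ?_ (by simp)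
  rintro _ ⟨F, rfl⟩
  exact (measureReal_eq_measureReal_iff).1 (h F)

theorem IsInfiniteTransitive.exists_edgesIn_supset (hG : IsInfiniteTransitive G)
    (F : Finset G.edgeSet) : ∃ Λ : Finset V, Λ.Nonempty ∧ F ⊆ edgesIn G Λ := by
  obtain ⟨o⟩ := hG.connected.nonempty
  refine ⟨insert o (F.biUnion fun e => (e : Sym2 V).toFinset), Finset.insert_nonempty _ _,
    fun e he => mem_edgesIn.2 fun x hx => Finset.mem_insert_of_mem ?_⟩
  exact Finset.mem_biUnion.2 ⟨e, he, Sym2.mem_toFinset.2 hx⟩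

/-- The probability that given edges are open converges in the infinite-volume limit. -/
theorem IsInfiniteTransitive.exists_tendsto_allOpen (hG : IsInfiniteTransitive G)
    (hp : p ∈ Set.Ioo (0 : ℝ) 1) (hq : 1 ≤ q) (F : Finset G.edgeSet) :
    ∃ c, Tendsto (fun Λ => rcMean G p q Λ (eventFn (allOpen F))) atTop (𝓝 c) := by
  have := hG.infinite
  obtain ⟨Λ₀, hne, hF⟩ := hG.exists_edgesIn_supset F
  have hb : ∀ Λ, (vertexBoundary G (Λ₀ ∪ Λ)).Nonempty := fun Λ =>
    vertexBoundary_nonempty hG.connected (hne.mono Finset.subset_union_left)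
  -- Monotonicity in the domain holds once the domain contains all the edges of `F`, whence the
  -- union with `Λ₀`.
  have anti : Antitone fun Λ => rcMean G p q (Λ₀ ∪ Λ) (eventFn (allOpen F)) := by
    intro Λ Λ' h
    refine rcMean_anti hp hq (Finset.union_subset_union_right h) (hb Λ) (hb Λ') (eventFn_nonneg _)
      (fun a b hab => eventFn_le_eventFn fun ha e he => ?_) fun a => le_antisymm
        (eventFn_le_eventFn fun ha e he => ?_) (eventFn_le_eventFn fun ha e he => ?_)
    · exact configOf_eq_true.2 (hab (configOf_eq_true.1 (ha e he)))
    · exact configOf_eq_true.2 (Finset.mem_inter.1 (configOf_eq_true.1 (ha e he))).1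
    · exact configOf_eq_true.2 (Finset.mem_inter.2 ⟨configOf_eq_true.1 (ha e he),
        edgesIn_mono Finset.subset_union_left (hF he)⟩)
  have lim := tendsto_atTop_ciInf anti ⟨0, by
    rintro _ ⟨Λ, rfl⟩
    exact mean_nonneg (wiredWeight_nonneg ⟨hp.1.le, hp.2.le⟩ hq _) (eventFn_nonneg _)⟩
  refine ⟨_, lim.congr' ?_⟩
  filter_upwards [eventually_ge_atTop Λ₀] with Λ hΛ
  rw [Finset.union_eq_right.2 hΛ]

/-- Two subsequential limits of the wired measures coincide. -/
theorem IsInfiniteTransitive.limit_unique (hG : IsInfiniteTransitive G)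
    (hp : p ∈ Set.Ioo (0 : ℝ) 1) (hq : 1 ≤ q) {l l' : Filter (Finset V)} [l.NeBot] [l'.NeBot]
    (hl : l ≤ atTop) (hl' : l' ≤ atTop) {μ ν : Measure (Config G)} [IsProbabilityMeasure μ]
    [IsProbabilityMeasure ν]
    (hμ : ∀ f : Config G →ᵇ ℝ, Tendsto (fun Λ : Finset V => ∫ ω, f ω ∂(finiteVolumeMeasure G p q Λ))
      l (𝓝 (∫ ω, f ω ∂μ)))
    (hν : ∀ f : Config G →ᵇ ℝ, Tendsto (fun Λ : Finset V => ∫ ω, f ω ∂(finiteVolumeMeasure G p q Λ))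
      l' (𝓝 (∫ ω, f ω ∂ν))) : μ = ν := by
  have := hG.countable
  have hp' : p ∈ Set.Icc (0 : ℝ) 1 := ⟨hp.1.le, hp.2.le⟩
  refine measure_ext_allOpen fun F => ?_
  obtain ⟨c, hc⟩ := hG.exists_tendsto_allOpen hp hq F
  have h1 := tendsto_rcMean_of_isClopen hp' hq hμ (isClopen_allOpen F)
  have h2 := tendsto_rcMean_of_isClopen hp' hq hν (isClopen_allOpen F)
  exact (tendsto_nhds_unique h1 (hc.mono_left hl)).trans
    (tendsto_nhds_unique h2 (hc.mono_left hl')).symm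

/-- The wired infinite-volume random-cluster measure exists. -/
theorem IsInfiniteTransitive.exists_isWiredLimit (hG : IsInfiniteTransitive G)
    (hp : p ∈ Set.Ioo (0 : ℝ) 1) (hq : 1 ≤ q) : ∃ μ, IsWiredLimit G p q μ := by
  have := hG.countable
  have lim : ∀ U : Ultrafilter (Finset V), ∃ μ : Measure (Config G), IsProbabilityMeasure μ ∧
      ∀ f : Config G →ᵇ ℝ, Tendsto (fun Λ : Finset V => ∫ ω, f ω ∂(finiteVolumeMeasure G p q Λ))
        U (𝓝 (∫ ω, f ω ∂μ)) := by
    intro U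
    let P : Finset V → ProbabilityMeasure (Config G) := fun Λ =>
      ⟨finiteVolumeMeasure G p q Λ, isProbabilityMeasure_finiteVolumeMeasure ⟨hp.1.le, hp.2⟩ hq Λ⟩
    obtain ⟨μ, -, hμ⟩ := isCompact_univ.ultrafilter_le_nhds (U.map P) (by simp)
    exact ⟨μ, μ.2, ProbabilityMeasure.tendsto_iff_forall_integral_tendsto.1
      (show Tendsto P U (𝓝 μ) from hμ)⟩
  -- Compactness provides a limit along every ultrafilter. These limits all coincide, because they
  -- agree on the events `allOpen F`, whose probabilities converge; hence convergence holds along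
  -- `atTop`.
  obtain ⟨μ, hμ, hlim⟩ := lim (Ultrafilter.of atTop)
  refine ⟨μ, hμ, fun f => (tendsto_iff_ultrafilter _ _ _).2 fun U hU => ?_⟩
  obtain ⟨ν, hν, hlim'⟩ := lim U
  rw [hG.limit_unique hp hq (Ultrafilter.of_le atTop) hU hlim hlim']
  exact hlim' f

theorem isWiredLimit_wiredMeasure (h : ∃ μ, IsWiredLimit G p q μ) :
    IsWiredLimit G p q (wiredMeasure G p q) := by
  rw [wiredMeasure, dif_pos h]
  exact h.choose_spec

/-! ### Percolation in infinite volume -/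

/-- Balls are finite, so a cluster is infinite exactly when it is unbounded; this writes the event
as a decreasing limit of local ones. -/
theorem IsInfiniteTransitive.connectedToInfinity_eq (hG : IsInfiniteTransitive G) (o : V) :
    connectedToInfinity G o = ⋂ n, reach G o n := by
  ext ω
  simp only [connectedToInfinity, Set.mem_ofPred_eq, Set.mem_iInter]
  constructor
  · intro h n
    by_contra hn
    refine h ((finite_closedBall hG.connected hG.locallyFinite o n).subset fun x hx => ?_)
    by_contra hx'
    exact hn ⟨x, (not_le.1 hx').le, hx⟩
  · intro h hfin
    obtain ⟨N, hN⟩ := (hfin.image (G.dist o)).bddAbove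
    obtain ⟨x, hx, hr⟩ := h (N + 1)
    have := hN ⟨x, hr, rfl⟩
    omega

/-- Absence of percolation in infinite volume makes the connection probabilities in the balls
small. -/
theorem IsInfiniteTransitive.exists_theta_lt_of_measure_eq_zero (hG : IsInfiniteTransitive G)
    (hp : p ∈ Set.Ioo (0 : ℝ) 1) (hq : 1 ≤ q) (o : V) {μ : Measure (Config G)}
    (hμ : IsWiredLimit G p q μ) (h0 : μ (connectedToInfinity G o) = 0) {ε : ℝ} (hε : 0 < ε) :
    ∃ m, theta G p q o m < ε := by
  have := hG.countable
  have := hμ.isProbabilityMeasure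
  have hp' : p ∈ Set.Icc (0 : ℝ) 1 := ⟨hp.1.le, hp.2.le⟩
  rw [hG.connectedToInfinity_eq] at h0
  have h1 := tendsto_measure_iInter_atTop (μ := μ) (s := reach G o)
    (fun n => (hG.isClopen_reach o n).isOpen.measurableSet.nullMeasurableSet)
    (fun m n h => reach_anti h) ⟨0, measure_ne_top _ _⟩
  rw [h0] at h1
  obtain ⟨n, hn⟩ := (h1.eventually (gt_mem_nhds (ENNReal.ofReal_pos.2 hε))).exists
  have hn' : μ.real (reach G o n) < ε := by
    rw [Measure.real, ← ENNReal.toReal_ofReal hε.le]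
    exact (ENNReal.toReal_lt_toReal (measure_ne_top _ _) ENNReal.ofReal_ne_top).2 hn
  obtain ⟨Λ, hΛ⟩ := eventually_atTop.1
    ((tendsto_rcMean_of_isClopen hp' hq hμ.tendsto (hG.isClopen_reach o n)).eventually
      (gt_mem_nhds hn'))
  obtain ⟨N, hN⟩ := (Λ.finite_toSet.image (G.dist o)).bddAbove
  -- The radius `N + n` is at least `N`, so the ball contains `Λ` and the limit bound applies, and
  -- at least `n`, so reaching it implies reaching distance `n`.
  refine ⟨N + n, lt_of_le_of_lt (rcMean_le_rcMean hp' hq fun a => ?_) (hΛ (ball G o (N + n)) ?_)⟩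
  · exact eventFn_le_eventFn fun h => reach_anti (Nat.le_add_left n N) h
  · intro x hx
    rw [hG.mem_ball]
    exact (hN ⟨x, hx, rfl⟩).trans (Nat.le_add_right N n)

/-- The infinite-volume percolation probability is at most the connection probabilities in balls
at a larger parameter. -/
theorem IsInfiniteTransitive.measure_le_theta (hG : IsInfiniteTransitive G) {s : ℝ} (hs : 0 ≤ s)
    (hsp : s ≤ p) (hp : p ∈ Set.Ioo (0 : ℝ) 1) (hq : 1 ≤ q) (o : V) {μ : Measure (Config G)}
    (hμ : IsWiredLimit G s q μ) (m : ℕ) :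
    μ.real (connectedToInfinity G o) ≤ theta G p q o m := by
  have := hG.countable
  have := hG.infinite
  have := hμ.isProbabilityMeasure
  have hs' : s ∈ Set.Icc (0 : ℝ) 1 := ⟨hs, hsp.trans hp.2.le⟩
  refine le_trans (measureReal_mono (s₂ := reach G o m) ?_) ?_
  · rw [hG.connectedToInfinity_eq]
    exact Set.iInter_subset _ m
  · refine le_of_tendsto (tendsto_rcMean_of_isClopen hs' hq hμ.tendsto (hG.isClopen_reach o m)) ?_
    filter_upwards [eventually_ge_atTop (ball G o m)] with Λ hΛ
    refine le_trans ?_ (hG.rcMean_reach_le_theta hp hq hΛ)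
    exact rcMean_monotoneOn hq (vertexBoundary_nonempty hG.connected
      ⟨o, hΛ (hG.center_mem_ball o m)⟩) (eventFn_nonneg _) (eventFn_reach_mono o m)
      ⟨hs, hsp.trans_lt hp.2⟩ ⟨hp.1.le, hp.2⟩ hsp

/-! ### The parameter `p = 1` -/

theorem rcMean_one (hq : 1 ≤ q) (Λ : Finset V) (f : Finset G.edgeSet → ℝ) :
    rcMean G 1 q Λ f = f (edgesIn G Λ) := by
  have h0 : ∀ a ∈ (edgesIn G Λ).powerset, a ≠ edgesIn G Λ → wiredWeight G 1 q Λ a = 0 := by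
    intro a ha hne
    rw [Finset.mem_powerset] at ha
    have : (edgesIn G Λ \ a).card ≠ 0 := by
      rw [Finset.card_ne_zero, Finset.sdiff_nonempty]
      exact fun h => hne (ha.antisymm h)
    rw [wiredWeight, sub_self, zero_pow this, mul_zero, zero_mul]
  have hpos : 0 < wiredWeight G 1 q Λ (edgesIn G Λ) := by
    rw [wiredWeight, Finset.sdiff_self, Finset.card_empty, pow_zero, one_pow, one_mul, one_mul]
    exact pow_pos (by linarith) _
  rw [rcMean, mean,
    Finset.sum_eq_single_of_mem _ (Finset.mem_powerset_self _) fun a ha h => by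
      rw [h0 a ha h, zero_mul],
    Finset.sum_eq_single_of_mem _ (Finset.mem_powerset_self _) h0,
    mul_div_cancel_left₀ _ hpos.ne']

theorem IsInfiniteTransitive.eventually_mem_edgesIn (hG : IsInfiniteTransitive G)
    (e : G.edgeSet) : ∀ᶠ Λ : Finset V in atTop, e ∈ edgesIn G Λ := by
  obtain ⟨Λ₀, -, h⟩ := hG.exists_edgesIn_supset {e}
  filter_upwards [eventually_ge_atTop Λ₀] with Λ hΛ
  exact edgesIn_mono hΛ (h (Finset.mem_singleton_self e))

theorem IsInfiniteTransitive.isWiredLimit_one (hG : IsInfiniteTransitive G) (hq : 1 ≤ q) :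
    IsWiredLimit G 1 q (Measure.dirac fun _ => true) where
  isProbabilityMeasure := inferInstance
  tendsto f := by
    have := hG.countable
    rw [integral_dirac]
    simp only [integral_finiteVolumeMeasure (G := G) (p := 1) (by simp) hq, rcMean_one hq]
    refine (f.continuous.tendsto _).comp (tendsto_pi_nhds.2 fun e => ?_)
    refine tendsto_const_nhds.congr' ?_
    filter_upwards [hG.eventually_mem_edgesIn e] with Λ hΛ
    exact (configOf_eq_true.2 hΛ).symm

/-- Stated for any wired limit because `wiredMeasure` is a chosen one: each edge is almost surely
open, and there are countably many edges, so the cluster of `o` is almost surely everything. -/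
theorem IsInfiniteTransitive.measure_pos_of_isWiredLimit_one (hG : IsInfiniteTransitive G)
    (hq : 1 ≤ q) (o : V) {μ : Measure (Config G)} (hμ : IsWiredLimit G 1 q μ) :
    0 < μ (connectedToInfinity G o) := by
  have := hG.countable
  have := hG.infinite
  have := hμ.isProbabilityMeasure
  have h1 : ∀ e : G.edgeSet, ∀ᵐ ω ∂μ, ω ∈ allOpen {e} := by
    intro e
    have lim := tendsto_rcMean_of_isClopen (by simp) hq hμ.tendsto (isClopen_allOpen {e})
    have lim' : Tendsto (fun Λ => rcMean G 1 q Λ (eventFn (allOpen {e}))) atTop (𝓝 1) := by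
      refine tendsto_const_nhds.congr' ?_
      filter_upwards [hG.eventually_mem_edgesIn e] with Λ hΛ
      rw [rcMean_one hq, eventFn, if_pos]
      intro e' he'
      rw [Finset.mem_singleton.1 he']
      exact configOf_eq_true.2 hΛ
    have h := tendsto_nhds_unique lim lim'
    exact (mem_ae_iff_prob_eq_one (isClopen_allOpen {e}).isOpen.measurableSet).2
      ((ENNReal.toReal_eq_one_iff _).1 h)
  have h2 : ∀ᵐ ω ∂μ, ω ∈ connectedToInfinity G o := by
    filter_upwards [ae_all_iff.2 h1] with ω hω
    have hle : G ≤ openGraph ω := fun x y hxy =>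
      ⟨hxy, hω ⟨s(x, y), hxy⟩ _ (Finset.mem_singleton_self _)⟩
    have : {x : V | (openGraph ω).Reachable o x} = Set.univ :=
      Set.eq_univ_of_forall fun x => (hG.connected.preconnected o x).mono hle
    rw [connectedToInfinity, Set.mem_ofPred_eq, this]
    exact Set.infinite_univ
  rw [pos_iff_ne_zero]
  intro h0
  have h3 : ∀ᵐ ω ∂μ, ω ∉ connectedToInfinity G o := measure_eq_zero_iff_ae_notMem.1 h0
  obtain ⟨ω, h4, h5⟩ := (h2.and h3).exists
  exact h5 h4

end Existence

/-! ### Finite-volume characterisation of the critical point. -/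

section CriticalPoint

variable {V : Type u} {G : SimpleGraph V} {p q : ℝ}

theorem bddBelow_criticalSet (o : V) : BddBelow
    {p : ℝ | p ∈ Set.Icc (0 : ℝ) 1 ∧ 0 < wiredMeasure G p q (connectedToInfinity G o)} :=
  ⟨0, fun _ hp => hp.1.1⟩

theorem criticalPoint_nonneg (o : V) : 0 ≤ criticalPoint G o q :=
  Real.sInf_nonneg fun _ hp => hp.1.1

/-- Ensures that the infimum is over a nonempty set, so that it is not the default value 0. -/
theorem IsInfiniteTransitive.one_mem_criticalSet (hG : IsInfiniteTransitive G) (hq : 1 ≤ q)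
    (o : V) : (1 : ℝ) ∈
      {p : ℝ | p ∈ Set.Icc (0 : ℝ) 1 ∧ 0 < wiredMeasure G p q (connectedToInfinity G o)} :=
  ⟨by simp, hG.measure_pos_of_isWiredLimit_one hq o
    (isWiredLimit_wiredMeasure ⟨_, hG.isWiredLimit_one hq⟩)⟩

theorem IsInfiniteTransitive.criticalPoint_le_one (hG : IsInfiniteTransitive G) (hq : 1 ≤ q)
    (o : V) : criticalPoint G o q ≤ 1 :=
  csInf_le (bddBelow_criticalSet o) (hG.one_mem_criticalSet hq o)

/-- Below the critical point, the connection probabilities in the balls are small. -/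
theorem IsInfiniteTransitive.exists_theta_lt_of_lt_criticalPoint (hG : IsInfiniteTransitive G)
    (hq : 1 ≤ q) (o : V) (hp : 0 < p) (hpc : p < criticalPoint G o q) {ε : ℝ} (hε : 0 < ε) :
    ∃ m, theta G p q o m < ε := by
  have hp1 : p < 1 := hpc.trans_le (hG.criticalPoint_le_one hq o)
  have hμ := isWiredLimit_wiredMeasure (hG.exists_isWiredLimit (p := p) ⟨hp, hp1⟩ hq)
  refine hG.exists_theta_lt_of_measure_eq_zero ⟨hp, hp1⟩ hq o hμ ?_ hε
  by_contra h0
  exact notMem_of_lt_csInf hpc (bddBelow_criticalSet o) ⟨⟨hp.le, hp1.le⟩, pos_iff_ne_zero.2 h0⟩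

/-- A finite-volume lower bound for the critical point. -/
theorem IsInfiniteTransitive.le_criticalPoint (hG : IsInfiniteTransitive G) (hq : 1 ≤ q) (o : V)
    (hp : p < 1) {t : ℝ} (ht : 0 < t) (ht' : t ≤ 1 / 2) (htp : 2 * t < p) {m : ℕ}
    (hm : theta G p q o m < t) : p - 2 * t ≤ criticalPoint G o q := by
  refine le_csInf ⟨1, hG.one_mem_criticalSet hq o⟩ ?_
  rintro s ⟨hs, hpos⟩
  by_contra! hlt
  -- Positive probability excludes the default zero measure, so existence comes for free, including
  -- at `s = 0`.
  have hex : ∃ μ, IsWiredLimit G s q μ := by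
    by_contra h
    rw [wiredMeasure, dif_neg h] at hpos
    simp at hpos
  have hμ := isWiredLimit_wiredMeasure hex
  have := hμ.isProbabilityMeasure
  have hreal : 0 < (wiredMeasure G s q).real (connectedToInfinity G o) :=
    ENNReal.toReal_pos hpos.ne' (measure_ne_top _ _)
  obtain ⟨M, hM⟩ := hG.exists_theta_lt hq o hp ht ht' htp hm
    (s := p - 2 * t) ⟨by linarith, le_rfl⟩ hreal
  exact absurd (hG.measure_le_theta hs.1 hlt.le ⟨by linarith, by linarith⟩ hq o hμ M) (not_le.2 hM)

end CriticalPoint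

end RandomCluster

end

theorem proposition1 (q : ℝ) (hq : 1 ≤ q)
    (V : ℕ → Type*) (G : ∀ n, SimpleGraph (V n)) (o : ∀ n, V n)
    (V' : Type*) (G' : SimpleGraph V') (o' : V')
    (hG : ∀ n, RandomCluster.IsInfiniteTransitive (G n))
    (hG' : RandomCluster.IsInfiniteTransitive G')
    (hconv : RandomCluster.ConvergesLocally G o G' o') :
    RandomCluster.criticalPoint G' o' q ≤
      Filter.liminf (fun n => RandomCluster.criticalPoint (G n) (o n) q) Filter.atTop := by
  -- A real `liminf` is meaningful only under such a bound; here all the critical points are at most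
  -- 1.
  have hcobdd : Filter.IsCoboundedUnder (· ≥ ·) Filter.atTop
      (fun n => RandomCluster.criticalPoint (G n) (o n) q) :=
    Filter.isCoboundedUnder_ge_of_le _ fun n => (hG n).criticalPoint_le_one hq (o n)
  refine le_of_forall_lt_imp_le_of_dense fun c hc => ?_
  refine Filter.le_liminf_of_le hcobdd ?_
  rcases le_or_gt c 0 with hc0 | hc0
  · exact Filter.Eventually.of_forall fun n => hc0.trans (RandomCluster.criticalPoint_nonneg (o n))
  obtain ⟨p, hcp, hp⟩ := exists_between hc
  have hp1 : p < 1 := hp.trans_le (hG'.criticalPoint_le_one hq o')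
  -- With `t = (p - c) / 2`, the bound `p - 2 * t` is exactly `c`; moreover `t ≤ 1 / 2` and `2 * t <
  -- p` because `0 < c < p < 1`.
  have ht : 0 < (p - c) / 2 := by linarith
  obtain ⟨m, hm⟩ := hG'.exists_theta_lt_of_lt_criticalPoint hq o' (hc0.trans hcp) hp ht
  obtain ⟨N, hN⟩ := hconv (m + 1)
  filter_upwards [Filter.eventually_ge_atTop N] with n hn
  rw [← RandomCluster.theta_eq_of_ballsIsomorphic (hG n) hG' (hN n hn)] at hm
  have := (hG n).le_criticalPoint hq (o n) hp1 ht (by linarith) (by linarith) hm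
  linarith
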